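/- Let $\lambda=(\lambda_1\ge\dots\ge\lambda_n\ge 0)$ and $\mu=(\mu_1\ge\dots\ge\mu_n\ge 0)$ be integer partitions (padded with zeros to length $n$) with $\mu_j\le\lambda_j$ for all $j$, and let $N=|\lambda|-|\mu|=\sum_j(\lambda_j-\mu_j)$. The Gelfand--Tsetlin polytope $\mathcal P_{\lambda/\mu,\mathbf 1}\subset\mathbb R^{(N+1)n}$ of the skew shape $\lambda/\mu$ and weight $\mathbf 1=(1,\dots,1)$ (of length $N$) is the set of all arrays of non-negative real numbers $(x^i_j)_{1\le i\le N+1,\,1\le j\le n}$ such that $$x^{i+1}_j\ge x^i_j\quad\text{and}\quad x^i_j\ge x^{i+1}_{j+1}$$ whenever both sides are defined, $x^{N+1}_j=\lambda_j$ and $x^1_j=\mu_j$ for all $j$, and $\sum_j x^{i+1}_j-\sum_j x^i_j=1$ for $1\le i\le N$. A polytope is integral if all its vertices are integer points. Given a polytope $\mathcal P$ and a total order $p_1<\dots<p_k$ of its vertices, the pulling triangulation $\Delta(\mathcal P)$ is defined recursively: if $p_1,\dots,p_k$ are affinely independent, then $\Delta(\mathcal P)=\{\{p_1,\dots,p_k\}\}$;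 otherwise $\Delta(\mathcal P)$ consists of all sets $\{p_k\}\cup\sigma$ with $\sigma\in\Delta(F)$, where $F$ runs over the facets of $\mathcal P$ that do not contain $p_k$ and the vertices of $F$ carry the induced order. A simplex in $\mathbb R^d$ with integer vertices is unimodular if the differences of its vertices generate the group of all integer vectors parallel to its affine hull (that is, it has normalized volume one). An integral polytope is compressed if, for every total order of its vertices, all simplices of the corresponding pulling triangulation are unimodular. If $\mathcal P_{\lambda/\mu,\mathbf 1}$ is integral, then it is compressed. -/

import Mathlib

/-! ## Convex polytopes, lattice points and pulling triangulations in `ℝ^ι` -/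

section Polytopes

variable {ι : Type*}

/-- A point of `ℝ^ι` all of whose coordinates are integers. -/
def IsIntegerPoint (x : ι → ℝ) : Prop :=
  ∀ i, ∃ z : ℤ, x i = (z : ℝ)

/-- All vertices of the polytope `P` are integer points. -/
def IsIntegralPolytope (P : Set (ι → ℝ)) : Prop :=
  ∀ v ∈ P.extremePoints ℝ, IsIntegerPoint v

open Classical in
/-- The dimension of (the affine hull of) a set, with `dim ∅ = -1`. -/
noncomputable def affineDim (S : Set (ι → ℝ)) : ℤ :=
  if S = ∅ then -1 else (Module.finrank ℝ (vectorSpan ℝ S) : ℤ)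

/-- `F` is a facet of the polytope `P`: a face, that is, the set of maximizers over `P` of some
linear functional (or the empty face), of dimension `dim P - 1`. -/
def IsFacet (P F : Set (ι → ℝ)) : Prop :=
  IsExposed ℝ P F ∧ affineDim F + 1 = affineDim P

/-- `IsPullingSimplex p Q σ` says that `σ` (given by its set of vertices) belongs to the pulling
triangulation of the polytope `Q` whose vertices occur in the sequence `p` and are ordered as in
that sequence:
* if the vertices of `Q` are affinely independent, the only simplex is the set of vertices of `Q`;
* otherwise the simplices are the sets `{p i} ∪ σ`, where `p i` is the last vertex of `Q`
  and `σ` belongs to the pulling triangulation (for the induced order) of a facet `F` of `Q`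
  that does not contain `p i`. -/
inductive IsPullingSimplex {k : ℕ} (p : Fin k → (ι → ℝ)) :
    Set (ι → ℝ) → Set (ι → ℝ) → Prop
  | simplex (Q : Set (ι → ℝ))
      (hQ : AffineIndependent ℝ (fun v : Q.extremePoints ℝ => (v : ι → ℝ))) :
      IsPullingSimplex p Q (Q.extremePoints ℝ)
  | pull (Q F σ : Set (ι → ℝ)) (i : Fin k)
      (hQ : ¬ AffineIndependent ℝ (fun v : Q.extremePoints ℝ => (v : ι → ℝ)))
      (hi : p i ∈ Q.extremePoints ℝ)
      (hlast : ∀ j, p j ∈ Q.extremePoints ℝ → j ≤ i)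
      (hF : IsFacet Q F) (hiF : p i ∉ F)
      (hσ : IsPullingSimplex p F σ) :
      IsPullingSimplex p Q (insert (p i) σ)

/-- The pulling triangulation of `P` with respect to the ordering `p 0, …, p (k - 1)` of its
vertices, as the set of its maximal simplices, each given by its set of vertices. -/
def pullingTriangulation {k : ℕ} (p : Fin k → (ι → ℝ)) (P : Set (ι → ℝ)) :
    Set (Set (ι → ℝ)) :=
  {σ | IsPullingSimplex p P σ}

/-- The points of `σ` are the vertices of a unimodular simplex (normalized volume one with respect
to the lattice of integer points in its affine hull): they are affinely independent integer points,
and their differences generate the group of all integer vectors parallel to their affine hull. -/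
def IsUnimodularSimplex (σ : Set (ι → ℝ)) : Prop :=
  AffineIndependent ℝ (fun v : σ => (v : ι → ℝ)) ∧
  (∀ v ∈ σ, IsIntegerPoint v) ∧
  ∀ z ∈ vectorSpan ℝ σ, IsIntegerPoint z → z ∈ vectorSpan ℤ σ

/-- The integral polytope `P` is compressed: for each total order on its vertices, the
corresponding pulling triangulation consists of unimodular simplices. -/
def IsCompressed (P : Set (ι → ℝ)) : Prop :=
  IsIntegralPolytope P ∧
  ∀ (k : ℕ) (p : Fin k → (ι → ℝ)), Function.Injective p → Set.range p = P.extremePoints ℝ →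
    ∀ σ ∈ pullingTriangulation p P, IsUnimodularSimplex σ

end Polytopes

/-! ## Gelfand–Tsetlin patterns and polytopes -/

/-- Parallelogram Gelfand–Tsetlin patterns with `m` rows of length `n`; `x (i, j)` is the `j`-th
entry of the `i`-th row, rows being counted from the bottom. -/
structure IsGTPattern {m n : ℕ} (x : Fin m × Fin n → ℝ) : Prop where
  nonneg : ∀ i j, 0 ≤ x (i, j)
  up : ∀ (i i' : Fin m) (j : Fin n), (i' : ℕ) = i + 1 → x (i, j) ≤ x (i', j)
  diag : ∀ (i i' : Fin m) (j j' : Fin n), (i' : ℕ) = i + 1 → (j' : ℕ) = j + 1 →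
    x (i', j') ≤ x (i, j)

/-- The Gelfand–Tsetlin polytope of the skew shape `lam / mu` (partitions padded with zeros to
length `n`) and weight `w` of length `N`: the patterns with `N + 1` rows, top row `lam`, bottom row
`mu`, whose successive row sums increase by the entries of `w`. -/
def gtPolytope {N n : ℕ} (lam mu : Fin n → ℕ) (w : Fin N → ℕ) :
    Set (Fin (N + 1) × Fin n → ℝ) :=
  {x | IsGTPattern x ∧
    (∀ j, x (Fin.last N, j) = (lam j : ℝ)) ∧
    (∀ j, x (0, j) = (mu j : ℝ)) ∧
    ∀ i : Fin N, ∑ j, x (i.succ, j) - ∑ j, x (i.castSucc, j) = (w i : ℝ)}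

/-! ## Integral polytopes of width one with respect to a system of inequalities -/

section WidthOne

variable {ι : Type*}

/-! An integral polytope cut out by integer inequalities is compressed as soon as every vertex has
slack at most one in each of them (`isCompressed_of_width_le_one`). When a vertex `p` is pulled over
a face `F` not containing it, some inequality is tight on `F` but not at `p`
(`exists_tight_constraint`). Its slack at `p` is then exactly one, so `p` lies at lattice distance
one from the simplices in `F`, and unimodularity passes to the cones over them
(`IsUnimodularSimplex.insert_apex`).

For weight `1` each entry grows by at most one per step, so only the diagonal inequalities can have
larger slack. Consider those between consecutive rows `j` and `j' = j + 1` of the shape. If `lam j'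
≤ mu j`, they follow from the monotonicity of the entries. If the rows overlap and neither has two
boxes, their slack is at most one. In the remaining case integrality makes them superfluous: a long
upper row must receive the first box of every pattern, and a long lower row the last one
(`first_step_of_isIntegralPolytope`, `last_step_of_isIntegralPolytope`). These forced steps are
themselves inequalities of width one, and they imply the diagonal ones (`diag_of_steps`).

The forcing rests on one obstruction, `not_isIntegralPolytope_of_zigzag`: four consecutive steps,
each adding two half boxes, give a point whose face of tight step inequalities has a non-integral
vertex. If some first or last step were elsewhere, the shape would have room for such a zigzag. -/

lemma IsIntegerPoint.sub {x y : ι → ℝ} (hx : IsIntegerPoint x) (hy : IsIntegerPoint y) :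
    IsIntegerPoint (x - y) := fun i => by
  obtain ⟨a, ha⟩ := hx i
  obtain ⟨b, hb⟩ := hy i
  exact ⟨a - b, by simp [ha, hb]⟩

lemma IsIntegerPoint.zsmul {x : ι → ℝ} (hx : IsIntegerPoint x) (m : ℤ) :
    IsIntegerPoint (m • x) := fun i => by
  obtain ⟨a, ha⟩ := hx i
  exact ⟨m * a, by simp [ha]⟩

lemma isUnimodularSimplex_empty : IsUnimodularSimplex (∅ : Set (ι → ℝ)) := by
  refine ⟨affineIndependent_of_subsingleton ℝ _, by simp, fun z hz _ => ?_⟩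
  rw [vectorSpan_empty, Submodule.mem_bot] at hz
  simp [hz]

/-- Adding an apex at lattice distance one from a unimodular simplex gives a unimodular simplex. -/
lemma IsUnimodularSimplex.insert_apex {σ : Set (ι → ℝ)} (hσ : IsUnimodularSimplex σ) {p : ι → ℝ}
    (hp : IsIntegerPoint p) (f : (ι → ℝ) →L[ℝ] ℝ) (c : ℝ)
    (hf : ∀ x, IsIntegerPoint x → ∃ z : ℤ, f x = z)
    (hfσ : ∀ x ∈ σ, f x = c) (hfp : f p = c + 1) : IsUnimodularSimplex (insert p σ) := by
  obtain ⟨hind, hint, hlat⟩ := hσ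
  have hpσ : p ∉ σ := fun h => by linarith [hfσ p h]
  refine ⟨?_, ?_, ?_⟩
  · let i : (insert p σ : Set (ι → ℝ)) := ⟨p, Set.mem_insert p σ⟩
    refine AffineIndependent.affineIndependent_of_notMem_span (i := i) ?_ ?_
    · let e : {y : (insert p σ : Set (ι → ℝ)) // y ≠ i} ↪ σ :=
        ⟨fun y => ⟨y.1.1, (Set.mem_insert_iff.1 y.1.2).resolve_left
          fun h => y.2 (Subtype.ext h)⟩, fun y z h => by
          simpa [Subtype.ext_iff] using h⟩
      exact hind.comp_embedding e
    · intro hmem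
      -- The other vertices span a subset of the hyperplane `f = c`, which misses `p`.
      have key : ∀ x ∈ affineSpan ℝ
          ((fun v : (insert p σ : Set (ι → ℝ)) => (v : ι → ℝ)) '' {x | x ≠ i}), f x = c := by
        intro x hx
        refine affineSpan_induction (p := fun x => f x = c) hx ?_ ?_
        · rintro _ ⟨⟨y, hy⟩, hyi, rfl⟩
          exact hfσ y ((Set.mem_insert_iff.1 hy).resolve_left fun h => hyi (Subtype.ext h))
        · intro r u v w hu hv hw
          simp only [vsub_eq_sub, vadd_eq_add, map_add, map_smul, map_sub, hu, hv, hw]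
          simp
      have := key p hmem
      linarith
  · rintro v (rfl | hv)
    · exact hp
    · exact hint v hv
  · intro z hz hzint
    rcases σ.eq_empty_or_nonempty with rfl | ⟨q, hq⟩
    · rw [insert_empty_eq, vectorSpan_singleton, Submodule.mem_bot] at hz
      simp [hz]
    · have hq' : q ∈ insert p σ := Set.mem_insert_of_mem _ hq
      rw [vectorSpan_eq_span_vsub_set_right ℝ hq', Set.image_insert_eq,
        Submodule.mem_span_insert] at hz
      obtain ⟨t, w, hw, rfl⟩ := hz
      rw [← vectorSpan_eq_span_vsub_set_right ℝ hq] at hw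
      have hfw : f w = 0 := by
        rw [vectorSpan_eq_span_vsub_set_right ℝ hq] at hw
        refine Submodule.span_induction ?_ (map_zero f) ?_ ?_ hw
        · rintro _ ⟨x, hx, rfl⟩
          simp [hfσ x hx, hfσ q hq]
        · intro x y _ _ hx hy
          simp [hx, hy]
        · intro a x _ hx
          simp [hx]
      -- Since `f` vanishes on `w` and is one on `p - q`, it reads off the coefficient `t`, which is
      -- therefore an integer; then `w` is an integer vector too.
      obtain ⟨m, hm⟩ := hf _ hzint
      have ht : t = m := by
        rw [← hm]
        simp [hfw, hfp, hfσ q hq]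
      have hpq : IsIntegerPoint (p - q) := hp.sub (hint q hq)
      have hwint : IsIntegerPoint w := by
        have := hzint.sub (hpq.zsmul m)
        convert this using 1
        simp [ht, ← Int.cast_smul_eq_zsmul ℝ]
      rw [ht, Int.cast_smul_eq_zsmul, vsub_eq_sub]
      exact add_mem (zsmul_mem (vsub_mem_vectorSpan ℤ (Set.mem_insert _ _) hq') m)
        (vectorSpan_mono ℤ (Set.subset_insert p σ) (hlat w hw hwint))

/-- A convex subset of a set cut out by inequalities contains a point at which only those
inequalities are tight that are tight on the whole subset. -/
lemma exists_forall_lt_of_convex {F : Set (ι → ℝ)} (hF : Convex ℝ F) (hne : F.Nonempty)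
    {S : Set (((ι → ℝ) →L[ℝ] ℝ) × ℝ)} (hS : S.Finite)
    (hFS : ∀ x ∈ F, ∀ q ∈ S, q.2 ≤ q.1 x) :
    ∃ x ∈ F, ∀ q ∈ S, (∃ y ∈ F, q.2 < q.1 y) → q.2 < q.1 x := by
  induction S, hS using Set.Finite.induction_on with
  | empty => exact ⟨hne.some, hne.some_mem, by simp⟩
  | @insert a S _ _ ih =>
    obtain ⟨x, hx, hxS⟩ := ih fun x hx q hq => hFS x hx q (Set.mem_insert_of_mem _ hq)
    by_cases h : ∃ y ∈ F, a.2 < a.1 y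
    · obtain ⟨y, hy, hya⟩ := h
      -- The midpoint of `x` and `y` keeps every inequality that is strict at either end.
      have hm := hF hx hy (by norm_num : (0 : ℝ) ≤ 1 / 2) (by norm_num : (0 : ℝ) ≤ 1 / 2)
        (by norm_num)
      refine ⟨_, hm, ?_⟩
      rintro q (rfl | hq) hq'
      · have := hFS x hx q (Set.mem_insert _ _)
        simp only [map_add, map_smul, smul_eq_mul]
        linarith
      · have h1 := hFS y hy q (Set.mem_insert_of_mem _ hq)
        have h2 := hxS q hq hq'
        simp only [map_add, map_smul, smul_eq_mul]
        linarith
    · refine ⟨x, hx, ?_⟩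
      rintro q (rfl | hq) hq'
      · exact absurd hq' h
      · exact hxS q hq hq'

/-- If no segment of a polyhedron starting at `p` has a point of `F` in its interior, then some
defining inequality is tight on `F` but not at `p`. -/
lemma exists_tight_constraint {P F : Set (ι → ℝ)} (hF : Convex ℝ F) (hne : F.Nonempty)
    {S : Set (((ι → ℝ) →L[ℝ] ℝ) × ℝ)} (hS : S.Finite)
    (hP : P = {x | ∀ q ∈ S, q.2 ≤ q.1 x}) (hFP : F ⊆ P) {p : ι → ℝ} (hp : p ∈ P)
    (hpF : ∀ x ∈ F, ∀ y ∈ P, x ∉ openSegment ℝ p y) :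
    ∃ q ∈ S, (∀ x ∈ F, q.1 x = q.2) ∧ q.2 < q.1 p := by
  have hFS : ∀ x ∈ F, ∀ q ∈ S, q.2 ≤ q.1 x := fun x hx => by
    have := hFP hx
    rw [hP] at this
    exact this
  have hpS : ∀ q ∈ S, q.2 ≤ q.1 p := by
    rw [hP] at hp
    exact hp
  by_contra! hcon
  obtain ⟨x, hx, hxS⟩ := exists_forall_lt_of_convex hF hne hS hFS
  -- The segment from `p` to `x` can be prolonged inside `P`: inequalities strict at `x` survive a
  -- small move, and those tight on all of `F` are by assumption tight at `p`, hence constant along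
  -- the line.
  have hev : ∀ᶠ ε : ℝ in nhdsWithin 0 (Set.Ioi 0), ∀ q ∈ S, q.2 ≤ q.1 (x + ε • (x - p)) := by
    rw [Filter.eventually_all_finite hS]
    intro q hq
    by_cases h : ∃ y ∈ F, q.2 < q.1 y
    · have hc : Filter.Tendsto (fun ε : ℝ => q.1 (x + ε • (x - p))) (nhdsWithin 0 (Set.Ioi 0))
          (nhds (q.1 x)) := by
        have : Continuous fun ε : ℝ => q.1 (x + ε • (x - p)) := by fun_prop
        have h0 := this.tendsto 0
        simp only [zero_smul, add_zero] at h0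
        exact h0.mono_left nhdsWithin_le_nhds
      exact (hc.eventually (lt_mem_nhds (hxS q hq h))).mono fun _ h => h.le
    · push Not at h
      have htight : ∀ y ∈ F, q.1 y = q.2 := fun y hy => le_antisymm (h y hy) (hFS y hy q hq)
      have hpq : q.1 p = q.2 := le_antisymm (hcon q hq htight) (hpS q hq)
      refine Filter.Eventually.of_forall fun ε => ?_
      simp [htight x hx, hpq]
  obtain ⟨ε, hε, hε0⟩ := (hev.and self_mem_nhdsWithin).exists
  have hε0 : 0 < ε := hε0
  refine hpF x hx (x + ε • (x - p)) (by rw [hP]; exact hε) ?_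
  have h1 : 0 < 1 + ε := by linarith
  refine ⟨ε / (1 + ε), 1 / (1 + ε), by positivity, by positivity, by field_simp; ring, ?_⟩
  ext i
  simp only [Pi.add_apply, Pi.smul_apply, Pi.sub_apply, smul_eq_mul]
  field_simp
  ring

/-- A face of a polytope of width one all of whose vertices are affinely independent is a
unimodular simplex. -/
lemma isUnimodularSimplex_extremePoints [Finite ι] {P Q : Set (ι → ℝ)}
    (hint : IsIntegralPolytope P) {S : Set (((ι → ℝ) →L[ℝ] ℝ) × ℝ)} (hS : S.Finite)
    (hP : P = {x | ∀ q ∈ S, q.2 ≤ q.1 x})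
    (hSf : ∀ q ∈ S, ∀ x, IsIntegerPoint x → ∃ z : ℤ, q.1 x = z)
    (hSw : ∀ q ∈ S, ∀ v ∈ P.extremePoints ℝ, q.2 < q.1 v → q.1 v = q.2 + 1)
    (hQ : IsExtreme ℝ P Q) (hQconv : Convex ℝ Q) (hQcomp : IsCompact Q)
    (hind : AffineIndependent ℝ (fun v : Q.extremePoints ℝ => (v : ι → ℝ))) :
    IsUnimodularSimplex (Q.extremePoints ℝ) := by
  have := Fintype.ofFinite ι
  have hfin : (Q.extremePoints ℝ).Finite := finite_set_of_fin_dim_affineIndependent ℝ hind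
  have hQhull : Q = convexHull ℝ (Q.extremePoints ℝ) := by
    rw [← (hfin.isClosed_convexHull ℝ).closure_eq]
    exact (closure_convexHull_extremePoints hQcomp hQconv).symm
  -- Vertices are added one at a time. The constraint used for `p` is tight on the whole facet of
  -- `Q` opposite to `p`, hence on `τ`.
  have hsub : ∀ τ : Set (ι → ℝ), τ.Finite → τ ⊆ Q.extremePoints ℝ → IsUnimodularSimplex τ := by
    intro τ hτ
    induction τ, hτ using Set.Finite.induction_on with
    | empty => exact fun _ => isUnimodularSimplex_empty
    | @insert p τ hpτ _ ih =>
      intro hsub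
      have hpQ : p ∈ Q.extremePoints ℝ := hsub (Set.mem_insert _ _)
      have hτQ : τ ⊆ Q.extremePoints ℝ := (Set.subset_insert _ _).trans hsub
      have hpP := hQ.extremePoints_subset_extremePoints hpQ
      rcases τ.eq_empty_or_nonempty with rfl | ⟨t, ht⟩
      -- Over the empty simplex any functional works; `0` with `c = -1` gives `f p = c + 1`.
      · exact (isUnimodularSimplex_empty).insert_apex (hint p hpP) 0 (-1)
          (fun x _ => ⟨0, by simp⟩) (by simp) (by simp)
      set V := Q.extremePoints ℝ \ {p} with hV
      have htV : t ∈ V := ⟨hτQ ht, fun h => hpτ (h ▸ ht)⟩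
      have hpV : p ∉ affineSpan ℝ V := by
        have := hind.notMem_affineSpan_sdiff ⟨p, hpQ⟩ Set.univ
        refine fun h => this (affineSpan_mono ℝ ?_ h)
        intro v hv
        exact ⟨⟨v, hv.1⟩, ⟨trivial, fun h => hv.2 (congrArg Subtype.val h)⟩, rfl⟩
      have hpt : p - t ∉ vectorSpan ℝ V := by
        rw [← direction_affineSpan]
        intro h
        exact hpV ((AffineSubspace.vsub_right_mem_direction_iff_mem
          (subset_affineSpan ℝ V htV) p).1 h)
      obtain ⟨g, hg, hgV⟩ := Submodule.exists_le_ker_of_notMem hpt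
      have hgt : ∀ v ∈ V, g v = g t := fun v hv => by
        have := hgV (vsub_mem_vectorSpan ℝ hv htV)
        rw [LinearMap.mem_ker, vsub_eq_sub, map_sub] at this
        linarith
      obtain ⟨g, hg, hgt⟩ : ∃ g : (ι → ℝ) →ₗ[ℝ] ℝ, g t < g p ∧ ∀ v ∈ V, g v = g t := by
        rw [map_sub, sub_ne_zero] at hg
        rcases lt_or_gt_of_ne hg with h | h
        · exact ⟨-g, by simpa using h, fun v hv => by simp [hgt v hv]⟩
        · exact ⟨g, h, hgt⟩
      have hQge : ∀ y ∈ Q, g t ≤ g y := by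
        intro y hy
        rw [hQhull] at hy
        refine convexHull_min (t := {y | g t ≤ g y}) ?_
          (convex_halfSpace_ge g.isLinear _) hy
        intro v hv
        by_cases h : v = p
        · exact h ▸ hg.le
        · exact (hgt v ⟨hv, h⟩).ge
      have hVeq : ∀ y ∈ convexHull ℝ V, g y = g t := by
        intro y hy
        exact convexHull_min (t := {y | g y = g t}) hgt (convex_hyperplane g.isLinear _) hy
      have hVQ : convexHull ℝ V ⊆ Q :=
        convexHull_min (fun v hv => hv.1.1) hQconv
      obtain ⟨q, hq, hqV, hqp⟩ := exists_tight_constraint (convex_convexHull ℝ V)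
        ⟨t, subset_convexHull ℝ V htV⟩ hS hP (hVQ.trans hQ.subset) hpP.1 (by
          intro x hx y hy hxy
          have hyQ : y ∈ Q := hQ.right_mem_of_mem_openSegment hpP.1 hy (hVQ hx) hxy
          obtain ⟨a, b, ha, hb, hab, rfl⟩ := hxy
          have h1 := hVeq _ hx
          rw [map_add, map_smul, map_smul, smul_eq_mul, smul_eq_mul] at h1
          have h2 := hQge y hyQ
          have h3 : b * g t ≤ b * g y := by gcongr
          have h4 : a * g t < a * g p := by gcongr
          have h5 : g t = a * g t + b * g t := by rw [← add_mul, hab, one_mul]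
          linarith)
      exact (ih hτQ).insert_apex (hint p hpP) q.1 q.2 (hSf q hq)
        (fun x hx => hqV x (subset_convexHull ℝ V ⟨hτQ hx, fun h => hpτ (h ▸ hx)⟩))
        (hSw q hq p hpP hqp)
  exact hsub _ hfin subset_rfl

/-- An integral polytope defined by inequalities with integer coefficients on each of which every
vertex has slack at most one is compressed. -/
theorem isCompressed_of_width_le_one [Finite ι] {P : Set (ι → ℝ)}
    (hint : IsIntegralPolytope P) (hcomp : IsCompact P)
    {S : Set (((ι → ℝ) →L[ℝ] ℝ) × ℝ)} (hS : S.Finite)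
    (hP : P = {x | ∀ q ∈ S, q.2 ≤ q.1 x})
    (hSf : ∀ q ∈ S, ∀ x, IsIntegerPoint x → ∃ z : ℤ, q.1 x = z)
    (hSc : ∀ q ∈ S, ∃ z : ℤ, q.2 = z)
    (hSw : ∀ q ∈ S, ∀ v ∈ P.extremePoints ℝ, q.1 v ≤ q.2 + 1) : IsCompressed P := by
  have hSw' : ∀ q ∈ S, ∀ v ∈ P.extremePoints ℝ, q.2 < q.1 v → q.1 v = q.2 + 1 := by
    intro q hq v hv hlt
    obtain ⟨a, ha⟩ := hSf q hq v (hint v hv)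
    obtain ⟨b, hb⟩ := hSc q hq
    refine le_antisymm (hSw q hq v hv) ?_
    rw [ha, hb] at hlt ⊢
    exact_mod_cast hlt
  have hconv : Convex ℝ P := by
    rw [hP]
    intro x hx y hy a b ha hb hab q hq
    have h1 : a * q.2 ≤ a * q.1 x := mul_le_mul_of_nonneg_left (hx q hq) ha
    have h2 : b * q.2 ≤ b * q.1 y := mul_le_mul_of_nonneg_left (hy q hq) hb
    have h3 : q.2 = a * q.2 + b * q.2 := by rw [← add_mul, hab, one_mul]
    simp only [map_add, map_smul, smul_eq_mul]
    linarith
  refine ⟨hint, fun k p _ _ σ hσ => ?_⟩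
  -- Every polytope met in the recursion is a face of `P`, so the inequalities of `P` serve at each
  -- level.
  suffices h : ∀ Q σ, IsPullingSimplex p Q σ → IsExtreme ℝ P Q → Convex ℝ Q → IsCompact Q →
      σ ⊆ Q ∧ IsUnimodularSimplex σ from (h P σ hσ (IsExtreme.refl ℝ P) hconv hcomp).2
  intro Q σ h
  induction h with
  | simplex Q hQ =>
    intro hext hQc hQk
    exact ⟨extremePoints_subset,
      isUnimodularSimplex_extremePoints hint hS hP hSf hSw' hext hQc hQk hQ⟩
  | pull Q F σ i _ hi _ hF hiF _ ih =>
    intro hext hQc hQk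
    have hFext : IsExtreme ℝ P F := hext.trans hF.1.isExtreme
    have hFc := hF.1.convex hQc
    obtain ⟨hσF, hσu⟩ := ih hFext hFc (hF.1.isCompact hQk)
    have hpP := hext.extremePoints_subset_extremePoints hi
    refine ⟨Set.insert_subset hi.1 (hσF.trans hF.1.subset), ?_⟩
    rcases F.eq_empty_or_nonempty with rfl | hne
    · rw [Set.subset_empty_iff.1 hσF]
      exact (isUnimodularSimplex_empty).insert_apex (hint _ hpP) 0 (-1)
          (fun x _ => ⟨0, by simp⟩) (by simp) (by simp)
    · obtain ⟨q, hq, hqF, hqp⟩ := exists_tight_constraint hFc hne hS hP hFext.subset hpP.1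
        fun x hx y hy hxy => hiF (hFext.left_mem_of_mem_openSegment hpP.1 hy hx hxy)
      exact hσu.insert_apex (hint _ hpP) q.1 q.2 (hSf q hq) (fun x hx => hqF x (hσF hx))
        (hSw' q hq _ hpP hqp)

/-- A continuous linear functional attains its minimum over a compact extreme subset of `P` at an
extreme point of `P`. -/
lemma exists_extremePoint_le {P G : Set (ι → ℝ)} (hG : IsExtreme ℝ P G) (hGk : IsCompact G)
    (f : (ι → ℝ) →L[ℝ] ℝ) {x : ι → ℝ} (hx : x ∈ G) :
    ∃ v ∈ P.extremePoints ℝ, v ∈ G ∧ f v ≤ f x := by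
  have hexp : IsExposed ℝ G ((-f).toExposed G) := ContinuousLinearMap.toExposed.isExposed
  obtain ⟨y, hy, hmin⟩ := hGk.exists_isMinOn ⟨x, hx⟩ f.continuous.continuousOn
  obtain ⟨v, hv⟩ := (hexp.isCompact hGk).extremePoints_nonempty
    ⟨y, hy, fun w hw => by simpa using hmin hw⟩
  refine ⟨v, (hG.trans hexp.isExtreme).extremePoints_subset_extremePoints hv, hv.1.1, ?_⟩
  simpa using hv.1.2 x hx

end WidthOne

/-! ## Gelfand–Tsetlin patterns as sequences of rows -/

section Rows

variable {n N : ℕ}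

/-- The rows `v` and `w` can be consecutive rows of a Gelfand–Tsetlin pattern whose weight has
the corresponding entry equal to one. -/
structure GTStep (v w : Fin n → ℝ) : Prop where
  le : ∀ j, v j ≤ w j
  diag : ∀ j j' : Fin n, (j' : ℕ) = j + 1 → w j' ≤ v j
  sum : ∑ j, w j - ∑ j, v j = 1

/-- If all entries but one stay the same in a step, then that entry increases by one. -/
lemma GTStep.eq_add_one {v w : Fin n → ℝ} (h : GTStep v w) (k : Fin n)
    (hk : ∀ l, l ≠ k → w l = v l) : w k = v k + 1 := by
  have h1 := h.sum
  rw [← Finset.sum_sub_distrib, Finset.sum_eq_single k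
    (fun l _ hl => by rw [hk l hl, sub_self]) (by simp)] at h1
  linarith

lemma GTStep.le_add_one {v w : Fin n → ℝ} (h : GTStep v w) (k : Fin n) : w k ≤ v k + 1 := by
  have h1 := h.sum
  rw [← Finset.sum_sub_distrib] at h1
  have h2 := Finset.single_le_sum (f := fun l => w l - v l)
    (fun l _ => sub_nonneg.2 (h.le l)) (Finset.mem_univ k)
  linarith

/-- If one entry increases by at least one in a step, all others stay the same. -/
lemma eq_of_add_one_le {v w : Fin n → ℝ} (hle : ∀ j, v j ≤ w j)
    (hsum : ∑ j, w j - ∑ j, v j = 1) {k l : Fin n} (hk : v k + 1 ≤ w k) (hl : l ≠ k) :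
    w l = v l := by
  have h1 := hsum
  rw [← Finset.sum_sub_distrib] at h1
  have h2 := Finset.sum_le_sum_of_subset_of_nonneg (f := fun l => w l - v l)
    (Finset.subset_univ {k, l}) (fun i _ _ => sub_nonneg.2 (hle i))
  rw [Finset.sum_pair hl.symm] at h2
  linarith [hle l]

/-- The `i`-th row of a pattern. -/
noncomputable def gtRow (x : Fin (N + 1) × Fin n → ℝ) (i : ℕ) : Fin n → ℝ :=
  fun j => if h : i < N + 1 then x (⟨i, h⟩, j) else 0

lemma gtRow_coe (x : Fin (N + 1) × Fin n → ℝ) (i : Fin (N + 1)) (j : Fin n) :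
    gtRow x i j = x (i, j) := by
  exact dif_pos i.2

lemma gtRow_castSucc (x : Fin (N + 1) × Fin n → ℝ) (i : Fin N) (j : Fin n) :
    gtRow x i j = x (i.castSucc, j) := gtRow_coe x i.castSucc j

lemma gtRow_succ (x : Fin (N + 1) × Fin n → ℝ) (i : Fin N) (j : Fin n) :
    gtRow x (i + 1) j = x (i.succ, j) := gtRow_coe x i.succ j

lemma gtRow_mono {z : ℕ → Fin n → ℝ} (hz : ∀ i < N, ∀ j, z i j ≤ z (i + 1) j)
    {a b : ℕ} (hab : a ≤ b) (hb : b ≤ N) (j : Fin n) : z a j ≤ z b j := by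
  induction b, hab using Nat.le_induction with
  | base => exact le_rfl
  | succ b _ ih => exact (ih (by omega)).trans (hz b (by omega) j)

/-- Nonnegativity drops out because the entries increase from the bottom row `mu`. -/
lemma mem_gtPolytope_iff {lam mu : Fin n → ℕ} {x : Fin (N + 1) × Fin n → ℝ} :
    x ∈ gtPolytope lam mu (fun _ : Fin N => 1) ↔
      (∀ j, gtRow x 0 j = mu j) ∧ (∀ j, gtRow x N j = lam j) ∧
        ∀ i < N, GTStep (gtRow x i) (gtRow x (i + 1)) := by
  have h0 : ∀ j, gtRow x 0 j = x (0, j) := fun j => gtRow_coe x 0 j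
  have hN : ∀ j, gtRow x N j = x (Fin.last N, j) := fun j => gtRow_coe x (Fin.last N) j
  simp only [h0, hN]
  constructor
  · rintro ⟨hx, htop, hbot, hsum⟩
    refine ⟨hbot, htop, fun i hi => ⟨fun j => ?_, fun j j' hj => ?_, ?_⟩⟩
    · rw [gtRow_castSucc x ⟨i, hi⟩, gtRow_succ x ⟨i, hi⟩]
      exact hx.up _ _ _ (by simp)
    · rw [gtRow_castSucc x ⟨i, hi⟩, gtRow_succ x ⟨i, hi⟩]
      exact hx.diag _ _ _ _ (by simp) hj
    · simpa only [gtRow_castSucc x ⟨i, hi⟩, gtRow_succ x ⟨i, hi⟩, Nat.cast_one] using hsum ⟨i, hi⟩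
  · rintro ⟨hbot, htop, hstep⟩
    have hnn : ∀ (i : Fin (N + 1)) j, 0 ≤ x (i, j) := fun i j => by
      have := gtRow_mono (fun i hi => (hstep i hi).le) (Nat.zero_le i) (by omega) j
      rw [gtRow_coe, h0, hbot] at this
      exact (Nat.cast_nonneg _).trans this
    refine ⟨⟨hnn, fun i i' j hi => ?_, fun i i' j j' hi hj => ?_⟩, htop, hbot, fun i => ?_⟩
    · rw [← gtRow_coe x, ← gtRow_coe x, hi]
      exact (hstep i (by omega)).le j
    · rw [← gtRow_coe x, ← gtRow_coe x, hi]
      exact (hstep i (by omega)).diag j j' hj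
    · simp only [← gtRow_castSucc, ← gtRow_succ, Nat.cast_one]
      exact (hstep i i.2).sum

/-- The pattern with prescribed rows. -/
def gtOfRows (N : ℕ) (z : ℕ → Fin n → ℝ) : Fin (N + 1) × Fin n → ℝ :=
  fun q => z q.1 q.2

lemma gtRow_gtOfRows (z : ℕ → Fin n → ℝ) {i : ℕ} (hi : i ≤ N) : gtRow (gtOfRows N z) i = z i := by
  ext j
  simp [gtRow, gtOfRows, Nat.lt_succ_of_le hi]

lemma gtOfRows_mem {lam mu : Fin n → ℕ} {z : ℕ → Fin n → ℝ} (h0 : ∀ j, z 0 j = mu j)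
    (hN : ∀ j, z N j = lam j) (hz : ∀ i < N, GTStep (z i) (z (i + 1))) :
    gtOfRows N z ∈ gtPolytope lam mu (fun _ : Fin N => 1) := by
  rw [mem_gtPolytope_iff]
  refine ⟨by rwa [gtRow_gtOfRows z (Nat.zero_le N)], by rwa [gtRow_gtOfRows z le_rfl],
    fun i hi => ?_⟩
  rw [gtRow_gtOfRows z (by omega), gtRow_gtOfRows z (by omega)]
  exact hz i hi

lemma isCompact_gtPolytope (lam mu : Fin n → ℕ) :
    IsCompact (gtPolytope lam mu (fun _ : Fin N => 1)) := by
  refine IsCompact.of_isClosed_subset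
    (isCompact_Icc (a := fun q => (mu q.2 : ℝ)) (b := fun q => (lam q.2 : ℝ))) ?_ ?_
  · have : gtPolytope lam mu (fun _ : Fin N => 1) =
        {x | (∀ i j, 0 ≤ x (i, j)) ∧
          (∀ (i i' : Fin (N + 1)) (j : Fin n), (i' : ℕ) = i + 1 → x (i, j) ≤ x (i', j)) ∧
          (∀ (i i' : Fin (N + 1)) (j j' : Fin n), (i' : ℕ) = i + 1 → (j' : ℕ) = j + 1 →
            x (i', j') ≤ x (i, j)) ∧
          (∀ j, x (Fin.last N, j) = (lam j : ℝ)) ∧ (∀ j, x (0, j) = (mu j : ℝ)) ∧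
          ∀ i : Fin N, ∑ j, x (i.succ, j) - ∑ j, x (i.castSucc, j) = ((1 : ℕ) : ℝ)} := by
      ext x
      exact ⟨fun h => ⟨h.1.nonneg, h.1.up, h.1.diag, h.2⟩,
        fun h => ⟨⟨h.1, h.2.1, h.2.2.1⟩, h.2.2.2⟩⟩
    rw [this]
    simp only [Set.ofPred_and, Set.ofPred_forall]
    refine IsClosed.inter ?_ (IsClosed.inter ?_ (IsClosed.inter ?_ (IsClosed.inter ?_
      (IsClosed.inter ?_ ?_)))) <;>
    repeat' first
      | refine isClosed_iInter fun _ => ?_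
      | exact isClosed_le (by fun_prop) (by fun_prop)
      | exact isClosed_eq (by fun_prop) (by fun_prop)
  · intro x hx
    rw [mem_gtPolytope_iff] at hx
    constructor <;> rintro ⟨i, j⟩
    · have := gtRow_mono (fun i hi => (hx.2.2 i hi).le) (Nat.zero_le i) (by omega) j
      rwa [gtRow_coe, hx.1] at this
    · have := gtRow_mono (fun i hi => (hx.2.2 i hi).le) (show (i : ℕ) ≤ N by omega) le_rfl j
      rwa [gtRow_coe, hx.2.1] at this

/-- Every point of a Gelfand–Tsetlin polytope has a vertex, on the same facets of the form
`x (i + 1, k) = x (i, k)`, at which a given functional is at most as large. -/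
lemma exists_gt_vertex_le {lam mu : Fin n → ℕ} {z : Fin (N + 1) × Fin n → ℝ}
    (hz : z ∈ gtPolytope lam mu (fun _ : Fin N => 1))
    (f : (Fin (N + 1) × Fin n → ℝ) →L[ℝ] ℝ) :
    ∃ v ∈ (gtPolytope lam mu (fun _ : Fin N => 1)).extremePoints ℝ, f v ≤ f z ∧
      ∀ i < N, ∀ k, gtRow z (i + 1) k = gtRow z i k → gtRow v (i + 1) k = gtRow v i k := by
  classical
  set P := gtPolytope lam mu (fun _ : Fin N => 1) with hP
  set I : Finset (Fin N × Fin n) :=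
    {q | gtRow z (q.1 + 1) q.2 = gtRow z q.1 q.2} with hI
  -- `φ` is the total slack of the step inequalities tight at `z`. It is nonnegative on `P` and zero
  -- at `z`, so a vertex of the face `φ = 0` keeps all of them tight.
  let φ : (Fin (N + 1) × Fin n → ℝ) →L[ℝ] ℝ :=
    ∑ q ∈ I, (ContinuousLinearMap.proj (R := ℝ) (φ := fun _ => ℝ) (q.1.succ, q.2) -
      ContinuousLinearMap.proj (R := ℝ) (φ := fun _ => ℝ) (q.1.castSucc, q.2))
  have hφ : ∀ x, φ x = ∑ q ∈ I, (gtRow x (q.1 + 1) q.2 - gtRow x q.1 q.2) := fun x => by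
    simp [φ, gtRow_castSucc, gtRow_succ]
  have hφz : φ z = 0 := by
    rw [hφ]
    exact Finset.sum_eq_zero fun q hq => sub_eq_zero.2 (Finset.mem_filter.1 hq).2
  have hnn : ∀ x ∈ P, ∀ q ∈ I, 0 ≤ gtRow x (q.1 + 1) q.2 - gtRow x q.1 q.2 := fun x hx q _ =>
    sub_nonneg.2 (((mem_gtPolytope_iff.1 hx).2.2 q.1 q.1.2).le q.2)
  have hexp : IsExposed ℝ P ((-φ).toExposed P) := ContinuousLinearMap.toExposed.isExposed
  obtain ⟨v, hv, hvG, hvf⟩ := exists_extremePoint_le hexp.isExtreme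
    (hexp.isCompact (isCompact_gtPolytope lam mu)) f (x := z) ⟨hz, fun y hy => by
      have : 0 ≤ φ y := by
        rw [hφ]
        exact Finset.sum_nonneg (hnn y hy)
      simpa [hφz] using this⟩
  refine ⟨v, hv, hvf, fun i hi k hk => ?_⟩
  have hv0 : φ v = 0 := by
    have h1 : φ v ≤ φ z := by simpa using hvG.2 z hz
    have h2 : 0 ≤ φ v := by
      rw [hφ]
      exact Finset.sum_nonneg (hnn v hv.1)
    linarith
  rw [hφ, Finset.sum_eq_zero_iff_of_nonneg (hnn v hv.1)] at hv0
  have := hv0 (⟨i, hi⟩, k) (by simp [hI, hk])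
  simpa [sub_eq_zero] using this

/-! ### Paths of partitions that add single boxes -/

lemma sum_update_add_one (κ : Fin n → ℕ) (k : Fin n) :
    ∑ j, Function.update κ k (κ k + 1) j = ∑ j, κ j + 1 := by
  have : Function.update κ k (κ k + 1) = κ + Pi.single k 1 := by
    ext j
    rcases eq_or_ne j k with rfl | hj <;> simp [*]
  simp [this, Finset.sum_add_distrib]

/-- Two nested partitions are joined by a sequence of partitions that increase by one box at a
time. -/
lemma exists_standard_path (m : ℕ) : ∀ {κ κ' : Fin n → ℕ}, Antitone κ → Antitone κ' → κ ≤ κ' →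
    ∑ j, κ' j = ∑ j, κ j + m →
    ∃ f : ℕ → Fin n → ℕ, f 0 = κ ∧ f m = κ' ∧
      ∀ i < m, Antitone (f i) ∧ Antitone (f (i + 1)) ∧
        ∃ k, f (i + 1) = Function.update (f i) k (f i k + 1) := by
  induction m with
  | zero =>
    intro κ κ' _ _ hle hsum
    have h : κ = κ' := by
      ext j
      exact (Finset.sum_eq_sum_iff_of_le fun j _ => hle j).1 hsum.symm j (Finset.mem_univ j)
    exact ⟨fun _ => κ, rfl, h, by simp⟩
  | succ m ih =>
    intro κ κ' hκ hκ' hle hsum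
    -- The box goes into the topmost deficient row: the rows above already agree with `κ'`, so the
    -- result is still a partition.
    obtain ⟨k, hk, hmin⟩ : ∃ k, κ k < κ' k ∧ ∀ l < k, κ l = κ' l := by
      have hne : ∃ k, κ k < κ' k := by
        by_contra! h
        have := Finset.sum_le_sum fun j (_ : j ∈ Finset.univ) => h j
        omega
      obtain ⟨k, hk⟩ := WellFounded.has_min (wellFounded_lt (α := Fin n)) {k | κ k < κ' k} hne
      exact ⟨k, hk.1, fun l hl => le_antisymm (hle l) (not_lt.1 fun h => hk.2 l h hl)⟩
    set κ₁ := Function.update κ k (κ k + 1) with hκ₁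
    have h1 : Antitone κ₁ := by
      intro a b hab
      have hb := hκ hab
      rcases eq_or_ne b k with rfl | hbk
      · rcases eq_or_ne a b with rfl | hak
        · exact le_rfl
        · have := hmin a (lt_of_le_of_ne hab hak)
          have := hκ' hab
          simp only [hκ₁, Function.update_self, Function.update_of_ne hak]
          omega
      · rcases eq_or_ne a k with rfl | hak
        · simp only [hκ₁, Function.update_self, Function.update_of_ne hbk]
          omega
        · simpa only [hκ₁, Function.update_of_ne hak, Function.update_of_ne hbk]
    have h2 : κ₁ ≤ κ' := by
      intro a
      rcases eq_or_ne a k with rfl | hak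
      · simpa [hκ₁] using hk
      · simpa [hκ₁, hak] using hle a
    have h3 : ∑ j, κ' j = ∑ j, κ₁ j + m := by
      rw [hκ₁, sum_update_add_one, hsum]
      omega
    obtain ⟨f, hf0, hfm, hf⟩ := ih h1 hκ' h2 h3
    refine ⟨fun i => Nat.casesOn i κ f, rfl, hfm, fun i hi => ?_⟩
    cases i with
    | zero =>
      refine ⟨hκ, ?_, k, hf0⟩
      change Antitone (f 0)
      rwa [hf0]
    | succ i => exact hf i (by omega)

/-- Adding a box to a partition gives a step of a pattern. -/
lemma gtStep_of_update {κ κ' : Fin n → ℕ} (hκ : Antitone κ) (hκ' : Antitone κ') {k : Fin n}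
    (h : κ' = Function.update κ k (κ k + 1)) :
    GTStep (fun j => (κ j : ℝ)) (fun j => (κ' j : ℝ)) := by
  refine ⟨fun j => ?_, fun j j' hj => ?_, ?_⟩
  · rcases eq_or_ne j k with rfl | hj
    · simp [h]
    · simp [h, hj]
  · have hjj : j ≤ j' := Fin.le_def.2 (by omega)
    rcases eq_or_ne j' k with rfl | hj'
    · have hne : j ≠ j' := fun h => by omega
      have : κ j = κ' j := by simp [h, hne]
      rw [this]
      exact_mod_cast hκ' hjj
    · have : κ' j' = κ j' := by simp [h, hj']
      rw [this]
      exact_mod_cast hκ hjj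
  · have : ∑ j, κ' j = ∑ j, κ j + 1 := by
      rw [h, sum_update_add_one]
    rw [← Nat.cast_sum, ← Nat.cast_sum, this]
    simp

end Rows

/-! ## Non-integral Gelfand–Tsetlin polytopes -/

section Obstruction

variable {n N : ℕ}

/-- The indicator function of the row `a`. -/
def rowInd (a : ℕ) (l : Fin n) : ℕ := if (l : ℕ) = a then 1 else 0

lemma rowInd_cases (a : ℕ) (l : Fin n) :
    (rowInd a l = 0 ∧ (l : ℕ) ≠ a) ∨ (rowInd a l = 1 ∧ (l : ℕ) = a) := by
  unfold rowInd
  split_ifs <;> simp [*]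

lemma sum_rowInd {a : ℕ} (ha : a < n) : ∑ l : Fin n, rowInd a l = 1 := by
  rw [Finset.sum_eq_single (⟨a, ha⟩ : Fin n)]
  · simp [rowInd]
  · intro b _ hb
    simpa [rowInd, Fin.ext_iff] using hb
  · simp

/-- Half-integral rows are handled through their doubles in `ℕ`, so a step of weight one adds two.
-/
lemma gtStep_half {u u' : Fin n → ℕ} (hle : ∀ j, u j ≤ u' j)
    (hdiag : ∀ j j' : Fin n, (j' : ℕ) = j + 1 → u' j' ≤ u j) (hsum : ∑ j, u' j = ∑ j, u j + 2) :
    GTStep (fun j => (u j : ℝ) / 2) (fun j => (u' j : ℝ) / 2) := by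
  refine ⟨fun j => ?_, fun j j' hj => ?_, ?_⟩
  · have : (u j : ℝ) ≤ u' j := by exact_mod_cast hle j
    linarith
  · have : (u' j' : ℝ) ≤ u j := by exact_mod_cast hdiag j j' hj
    linarith
  · rw [← Finset.sum_div, ← Finset.sum_div, ← Nat.cast_sum, ← Nat.cast_sum, hsum]
    push_cast
    ring

lemma antitone_of_succ {κ : Fin n → ℕ} (h : ∀ k l : Fin n, (l : ℕ) = k + 1 → κ l ≤ κ k) :
    Antitone κ := by
  have key : ∀ d (a b : Fin n), (b : ℕ) = a + d → κ b ≤ κ a := by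
    intro d
    induction d with
    | zero =>
      intro a b hab
      rw [Fin.ext hab]
    | succ d ih =>
      intro a b hab
      exact (h ⟨a + d, by omega⟩ b (by simp; omega)).trans (ih a _ rfl)
  intro a b hab
  exact key (b - a) a b (by have := Fin.le_def.1 hab; omega)

/-- Two sequences of rows that have the same steps in a range in which only one entry changes at
each step keep the same difference. -/
lemma sub_eq_sub_of_single_steps {z t : ℕ → Fin n → ℝ} {a : ℕ} (d : ℕ)
    (hz : ∀ i, a ≤ i → i < a + d → GTStep (z i) (z (i + 1)))
    (ht : ∀ i, a ≤ i → i < a + d → GTStep (t i) (t (i + 1)))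
    (hzk : ∀ i, a ≤ i → i < a + d → ∃ k, ∀ l, l ≠ k → z (i + 1) l = z i l)
    (htight : ∀ i, a ≤ i → i < a + d → ∀ k, z (i + 1) k = z i k → t (i + 1) k = t i k)
    (l : Fin n) : t (a + d) l - z (a + d) l = t a l - z a l := by
  induction d with
  | zero => simp
  | succ d ih =>
    rw [← ih (fun i h h' => hz i h (by omega)) (fun i h h' => ht i h (by omega))
      (fun i h h' => hzk i h (by omega)) (fun i h h' => htight i h (by omega))]
    obtain ⟨k, hk⟩ := hzk (a + d) (by omega) (by omega)
    have hk' : ∀ l, l ≠ k → t (a + d + 1) l = t (a + d) l :=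
      fun l hl => htight (a + d) (by omega) (by omega) l (hk l hl)
    rw [← add_assoc]
    rcases eq_or_ne l k with rfl | hl
    · rw [(hz (a + d) (by omega) (by omega)).eq_add_one l hk,
        (ht (a + d) (by omega) (by omega)).eq_add_one l hk']
      ring
    · rw [hk l hl, hk' l hl]

/-- The doubled rows of a pattern that passes from the partition `κ` to the partition `κ'` in four
steps, each of which adds two halves of boxes. -/
def zigzag (p : ℕ) (f g : ℕ → Fin n → ℕ) (u₁ u₂ u₃ : Fin n → ℕ) (i : ℕ) : Fin n → ℕ :=
  if i ≤ p then fun l => 2 * f i l else if i = p + 1 then u₁ else if i = p + 2 then u₂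
  else if i = p + 3 then u₃ else fun l => 2 * g (i - (p + 4)) l

/-- A row-by-row check. The critical case is the second inequality for the rows `A` and `B`, which
`hAB` makes an equality. -/
lemma zigzag_diag {κ κ' : Fin n → ℕ} {A B C D : ℕ}
    (hB : B = A + 1) (hCA : C ≠ A) (hDB : D ≠ B) (hCD : C ≠ D)
    (hκ : ∀ k l : Fin n, (l : ℕ) = k + 1 → κ l ≤ κ k)
    (hκA : ∀ k l : Fin n, (l : ℕ) = k + 1 → κ l + rowInd A l ≤ κ k + rowInd A k)
    (hκC : ∀ k l : Fin n, (l : ℕ) = k + 1 → κ l + rowInd C l ≤ κ k + rowInd C k)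
    (hκD : ∀ k l : Fin n, (l : ℕ) = k + 1 → κ l + rowInd A l + rowInd C l + rowInd D l ≤
      κ k + rowInd A k + rowInd C k + rowInd D k)
    (hκ' : ∀ k l : Fin n, (l : ℕ) = k + 1 → κ' l ≤ κ' k)
    (hκκ' : ∀ l, κ' l = κ l + rowInd A l + rowInd B l + rowInd C l + rowInd D l)
    (hAB : ∀ a b : Fin n, (a : ℕ) = A → (b : ℕ) = B → κ a = κ b + if C = B then 1 else 0)
    (k l : Fin n) (hkl : (l : ℕ) = k + 1) :
    (2 * κ l + rowInd A l + rowInd C l ≤ 2 * κ k) ∧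
    (2 * κ l + rowInd A l + rowInd B l + 2 * rowInd C l ≤
      2 * κ k + rowInd A k + rowInd C k) ∧
    (2 * κ l + 2 * rowInd A l + 2 * rowInd C l + rowInd B l + rowInd D l ≤
      2 * κ k + rowInd A k + rowInd B k + 2 * rowInd C k) ∧
    2 * κ' l ≤ 2 * κ k + 2 * rowInd A k + 2 * rowInd C k + rowInd B k + rowInd D k := by
  have h0 : (k : ℕ) = A → (C = B ∧ κ k = κ l + 1) ∨ (C ≠ B ∧ κ k = κ l) := fun h => by
    have := hAB k l h (by omega)
    split_ifs at this with hCB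
    · exact Or.inl ⟨hCB, this⟩
    · exact Or.inr ⟨hCB, this⟩
  have h1 := hκ k l hkl
  have h2 := hκA k l hkl
  have h3 := hκC k l hkl
  have h4 := hκD k l hkl
  have h5 := hκ' k l hkl
  have hl' := hκκ' l
  have hk' := hκκ' k
  have kA := rowInd_cases A k
  have kB := rowInd_cases B k
  have kC := rowInd_cases C k
  have kD := rowInd_cases D k
  have lA := rowInd_cases A l
  have lB := rowInd_cases B l
  have lC := rowInd_cases C l
  have lD := rowInd_cases D l
  clear hAB hκ hκA hκC hκD hκ' hκκ'
  refine ⟨?_, ?_, ?_, ?_⟩ <;> omega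

/-- The four steps add half boxes in the rows `A, C`, then `B, C`, then `A, D`, then `B, D`.
Minimise the entry of row `A` after the first of them over the vertices that keep the same step
inequalities tight. If such a vertex is integral, its first box lies in row `C`, so its second must
lie in row `B`; this violates the diagonal inequality with row `A`, which has not grown yet. -/
theorem not_isIntegralPolytope_of_zigzag {lam mu : Fin n → ℕ}
    (hlam : Antitone lam) (hmu : Antitone mu) (hN : ∑ j, lam j = ∑ j, mu j + N)
    {κ κ' : Fin n → ℕ} {A B C D : ℕ} (hBn : B < n) (hCn : C < n) (hDn : D < n)
    (hB : B = A + 1) (hCA : C ≠ A) (hDB : D ≠ B) (hCD : C ≠ D)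
    (hκ : ∀ k l : Fin n, (l : ℕ) = k + 1 → κ l ≤ κ k)
    (hκA : ∀ k l : Fin n, (l : ℕ) = k + 1 → κ l + rowInd A l ≤ κ k + rowInd A k)
    (hκC : ∀ k l : Fin n, (l : ℕ) = k + 1 → κ l + rowInd C l ≤ κ k + rowInd C k)
    (hκD : ∀ k l : Fin n, (l : ℕ) = k + 1 → κ l + rowInd A l + rowInd C l + rowInd D l ≤
      κ k + rowInd A k + rowInd C k + rowInd D k)
    (hκ' : ∀ k l : Fin n, (l : ℕ) = k + 1 → κ' l ≤ κ' k)
    (hκκ' : ∀ l, κ' l = κ l + rowInd A l + rowInd B l + rowInd C l + rowInd D l)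
    (hAB : ∀ a b : Fin n, (a : ℕ) = A → (b : ℕ) = B → κ a = κ b + if C = B then 1 else 0)
    (hmuκ : mu ≤ κ) (hκlam : κ' ≤ lam) :
    ¬ IsIntegralPolytope (gtPolytope lam mu (fun _ : Fin N => 1)) := by
  intro hint
  have hAn : A < n := by omega
  have hsA := sum_rowInd hAn
  have hsB := sum_rowInd hBn
  have hsC := sum_rowInd hCn
  have hsD := sum_rowInd hDn
  have hdiag := zigzag_diag hB hCA hDB hCD hκ hκA hκC hκD hκ' hκκ' hAB
  have hsumκ : ∑ j, κ' j = ∑ j, κ j + 4 := by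
    simp only [hκκ', Finset.sum_add_distrib, hsA, hsB, hsC, hsD]
  obtain ⟨p, hp⟩ := Nat.exists_eq_add_of_le (Finset.sum_le_sum fun j (_ : j ∈ Finset.univ) =>
    hmuκ j)
  obtain ⟨q, hq⟩ := Nat.exists_eq_add_of_le (Finset.sum_le_sum fun j (_ : j ∈ Finset.univ) =>
    hκlam j)
  obtain rfl : N = p + 4 + q := by omega
  obtain ⟨f, hf0, hfp, hf⟩ := exists_standard_path p hmu (antitone_of_succ hκ) hmuκ hp
  obtain ⟨g, hg0, hgq, hg⟩ := exists_standard_path q (antitone_of_succ hκ') hlam hκlam hq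
  set u₁ : Fin n → ℕ := fun l => 2 * κ l + rowInd A l + rowInd C l with hu₁
  set u₂ : Fin n → ℕ := fun l => 2 * κ l + rowInd A l + rowInd B l + 2 * rowInd C l with hu₂
  set u₃ : Fin n → ℕ := fun l => 2 * κ l + 2 * rowInd A l + 2 * rowInd C l + rowInd B l +
    rowInd D l with hu₃
  set z : ℕ → Fin n → ℝ := fun i l => (zigzag p f g u₁ u₂ u₃ i l : ℝ) / 2 with hz
  have zf : ∀ i ≤ p, z i = fun l => (f i l : ℝ) := fun i hi => by
    ext l
    simp [hz, zigzag, hi]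
  have z1 : z (p + 1) = fun l => (u₁ l : ℝ) / 2 := by
    ext l
    simp [hz, zigzag]
  have z2 : z (p + 2) = fun l => (u₂ l : ℝ) / 2 := by
    ext l
    simp [hz, zigzag]
  have z3 : z (p + 3) = fun l => (u₃ l : ℝ) / 2 := by
    ext l
    simp [hz, zigzag]
  have zg : ∀ i, z (p + 4 + i) = fun l => (g i l : ℝ) := fun i => by
    ext l
    have h1 : ¬ p + 4 + i ≤ p := by omega
    have h2 : p + 4 + i ≠ p + 1 := by omega
    have h3 : p + 4 + i ≠ p + 2 := by omega
    have h4 : p + 4 + i ≠ p + 3 := by omega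
    simp [hz, zigzag, h1, h2, h3, h4]
  have zp : z p = fun l => ((2 * κ l : ℕ) : ℝ) / 2 := by
    rw [zf p le_rfl, hfp]
    ext l
    simp
  have z4 : z (p + 4) = fun l => ((2 * κ' l : ℕ) : ℝ) / 2 := by
    have := zg 0
    rw [add_zero, hg0] at this
    rw [this]
    ext l
    simp
  have hstep : ∀ i < p + 4 + q, GTStep (z i) (z (i + 1)) := by
    intro i hi
    rcases lt_or_ge i p with h | h
    · obtain ⟨h1, h2, k, hk⟩ := hf i h
      rw [zf i h.le, zf (i + 1) h]
      exact gtStep_of_update h1 h2 hk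
    · obtain ⟨d, rfl⟩ := Nat.exists_eq_add_of_le h
      rcases lt_or_ge d 4 with hd | hd
      · have hs : ∀ {u u' : Fin n → ℕ}, z (p + d) = (fun l => (u l : ℝ) / 2) →
            z (p + d + 1) = (fun l => (u' l : ℝ) / 2) → (∀ j, u j ≤ u' j) →
            (∀ j j' : Fin n, (j' : ℕ) = j + 1 → u' j' ≤ u j) →
            ∑ j, u' j = ∑ j, u j + 2 → GTStep (z (p + d)) (z (p + d + 1)) := by
          intro u u' h h' h1 h2 h3
          rw [h, h']
          exact gtStep_half h1 h2 h3
        interval_cases d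
        · refine hs zp z1 (fun j => ?_) (fun j j' hj => (hdiag j j' hj).1) ?_
          · simp only [hu₁]
            omega
          · simp only [hu₁, Finset.sum_add_distrib, hsA, hsC, ← Finset.mul_sum]
        · refine hs z1 z2 (fun j => ?_) (fun j j' hj => (hdiag j j' hj).2.1) ?_
          · simp only [hu₁, hu₂]
            omega
          · simp only [hu₁, hu₂, Finset.sum_add_distrib, ← Finset.mul_sum, hsA, hsB, hsC]
            omega
        · refine hs z2 z3 (fun j => ?_) (fun j j' hj => (hdiag j j' hj).2.2.1) ?_
          · simp only [hu₂, hu₃]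
            omega
          · simp only [hu₂, hu₃, Finset.sum_add_distrib, ← Finset.mul_sum, hsA, hsB, hsC, hsD]
            omega
        · refine hs z3 z4 (fun j => ?_) (fun j j' hj => (hdiag j j' hj).2.2.2) ?_
          · simp only [hu₃, hκκ']
            omega
          · simp only [hu₃, hκκ', Finset.sum_add_distrib, ← Finset.mul_sum, hsA, hsB, hsC, hsD]
            omega
      · obtain ⟨e, rfl⟩ := Nat.exists_eq_add_of_le hd
        obtain ⟨h1, h2, k, hk⟩ := hg e (by omega)
        rw [← add_assoc, zg, add_assoc (p + 4), zg]
        exact gtStep_of_update h1 h2 hk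
  have hmem : gtOfRows (p + 4 + q) z ∈ gtPolytope lam mu (fun _ : Fin (p + 4 + q) => 1) := by
    refine gtOfRows_mem (fun j => ?_) (fun j => ?_) hstep
    · rw [zf 0 (Nat.zero_le p), hf0]
    · rw [zg q, hgq]
  obtain ⟨v, hv, hvA, htight⟩ := exists_gt_vertex_le hmem
    (ContinuousLinearMap.proj (R := ℝ) (φ := fun _ => ℝ)
      ((⟨p + 1, by omega⟩ : Fin (p + 4 + q + 1)), (⟨A, hAn⟩ : Fin n)))
  obtain ⟨hv0, hvN, hvstep⟩ := mem_gtPolytope_iff.1 hv.1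
  set t : ℕ → Fin n → ℝ := gtRow v with ht
  replace htight : ∀ i < p + 4 + q, ∀ k, z (i + 1) k = z i k → t (i + 1) k = t i k := by
    intro i hi k hk
    refine htight i hi k ?_
    rwa [gtRow_gtOfRows z (by omega), gtRow_gtOfRows z (by omega)]
  -- Before and after the four middle steps only one entry of `z` moves at a time, so the tight
  -- inequalities leave `t` no freedom there.
  have htp : ∀ l, t p l = κ l := by
    intro l
    have := sub_eq_sub_of_single_steps (a := 0) p (z := z) (t := t)
      (fun i _ h => hstep i (by omega)) (fun i _ h => hvstep i (by omega))
      (fun i _ h => by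
        obtain ⟨_, _, k, hk⟩ := hf i (by omega)
        refine ⟨k, fun l hl => ?_⟩
        rw [zf i (by omega), zf (i + 1) (by omega), hk]
        simp [hl])
      (fun i _ h => htight i (by omega)) l
    rw [zero_add, hv0, zf p le_rfl, zf 0 (Nat.zero_le p), hf0, hfp] at this
    linarith
  have ht4 : ∀ l, t (p + 4) l = κ' l := by
    intro l
    have := sub_eq_sub_of_single_steps (a := p + 4) q (z := z) (t := t)
      (fun i _ h => hstep i (by omega)) (fun i _ h => hvstep i (by omega))
      (fun i h' h => by
        obtain ⟨e, rfl⟩ := Nat.exists_eq_add_of_le h'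
        obtain ⟨_, _, k, hk⟩ := hg e (by omega)
        refine ⟨k, fun l hl => ?_⟩
        rw [zg e, add_assoc (p + 4), zg (e + 1), hk]
        simp [hl])
      (fun i _ h => htight i (by omega)) l
    have h0 := zg 0
    rw [add_zero, hg0] at h0
    rw [hvN, zg q, hgq, h0] at this
    linarith
  set a : Fin n := ⟨A, hAn⟩ with ha
  set b : Fin n := ⟨B, hBn⟩ with hb
  set c : Fin n := ⟨C, hCn⟩ with hc
  -- An integer between `κ a` and `κ a + 1 / 2`.
  have hta : t (p + 1) a = κ a := by
    obtain ⟨m, hm⟩ := hint v hv ((⟨p + 1, by omega⟩ : Fin (p + 4 + q + 1)), a)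
    rw [← gtRow_coe v] at hm
    change t (p + 1) a = m at hm
    have h1 : t (p + 1) a ≤ z (p + 1) a := by
      have := hvA
      simp only [ContinuousLinearMap.proj_apply] at this
      rwa [← gtRow_coe v, ← gtRow_coe (gtOfRows _ z),
        gtRow_gtOfRows z (show p + 1 ≤ p + 4 + q by omega)] at this
    have h2 := (hvstep p (by omega)).le a
    rw [htp, hm] at h2
    rw [z1, hm] at h1
    have h3 : u₁ a = 2 * κ a + 1 := by
      simp [hu₁, rowInd, ha, Ne.symm hCA]
    change (m : ℝ) ≤ (u₁ a : ℝ) / 2 at h1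
    rw [h3] at h1
    push_cast at h1
    have h4 : (m : ℝ) < κ a + 1 := by linarith
    have h5 : (κ a : ℤ) ≤ m := by exact_mod_cast h2
    have h6 : m < (κ a : ℤ) + 1 := by exact_mod_cast h4
    rw [hm, show m = (κ a : ℤ) by omega]
    simp
  have htc : t (p + 1) c = κ c + 1 := by
    rw [← htp c]
    refine (hvstep p (by omega)).eq_add_one c fun l hl => ?_
    rcases eq_or_ne l a with rfl | hla
    · rw [hta, htp]
    · refine htight p (by omega) l ?_
      rw [z1, zp]
      have h1 : (l : ℕ) ≠ A := fun h => hla (Fin.ext h)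
      have h2 : (l : ℕ) ≠ C := fun h => hl (Fin.ext h)
      simp [hu₁, rowInd, h1, h2]
  have hsupp : ∀ l, l ≠ b → l ≠ c → t (p + 2) l = t (p + 1) l := by
    intro l hlb hlc
    refine htight (p + 1) (by omega) l ?_
    rw [z1, z2]
    have h1 : (l : ℕ) ≠ B := fun h => hlb (Fin.ext h)
    have h2 : (l : ℕ) ≠ C := fun h => hlc (Fin.ext h)
    simp [hu₁, hu₂, rowInd, h1, h2]
  have hstep1 := hvstep (p + 1) (by omega)
  have hdiag := hstep1.diag a b hB
  rw [hta] at hdiag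
  have habκ := hAB a b rfl rfl
  -- If `C = B`, row `b` receives both boxes and reaches `κ b + 2 = κ a + 1`. Otherwise row `c`
  -- already has its final length `κ' c`, so the second box goes to row `b`, which reaches `κ b + 1
  -- = κ a + 1`.
  by_cases hCB : C = B
  · have hcb : c = b := Fin.ext hCB
    rw [hcb] at hsupp htc
    have h1 := hstep1.eq_add_one b fun l hl => hsupp l hl hl
    change t (p + 2) b = _ at h1
    rw [if_pos hCB] at habκ
    rw [habκ] at hdiag
    change t (p + 2) b ≤ _ at hdiag
    push_cast at hdiag
    linarith
  · have hcb : c ≠ b := fun h => hCB (by simpa [hc, hb] using h)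
    have hc2 : t (p + 2) c = t (p + 1) c := by
      refine le_antisymm ?_ (hstep1.le c)
      have h1 := (hvstep (p + 2) (by omega)).le c
      have h2 := (hvstep (p + 3) (by omega)).le c
      have h3 : κ' c = κ c + 1 := by
        rw [hκκ']
        simp [rowInd, hc, hCA, hCB, hCD]
      have h4 := ht4 c
      rw [h3] at h4
      push_cast at h4
      change t (p + 3) c ≤ t (p + 4) c at h2
      change t (p + 2) c ≤ t (p + 3) c at h1
      linarith
    have h1 := hstep1.eq_add_one b fun l hl => by
      rcases eq_or_ne l c with rfl | hlc
      · exact hc2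
      · exact hsupp l hl hlc
    have h2 : t (p + 1) b = κ b := by
      rw [← htp b]
      refine htight p (by omega) b ?_
      rw [z1, zp]
      have h1 : B ≠ A := by omega
      simp [hu₁, rowInd, hb, h1, Ne.symm hCB]
    rw [if_neg hCB, add_zero] at habκ
    rw [habκ] at hdiag
    linarith

end Obstruction

/-! ## Shapes whose Gelfand–Tsetlin polytope is not integral -/

section Shapes

variable {n N : ℕ}

/-- The partition that agrees with `lam`, up to a box in row `k`, above the row `j` and with `mu`
below the row `j + 1`, and whose rows `j` and `j + 1` have lengths `x` and `y`. -/
def twoRowPartition (lam mu : Fin n → ℕ) (j k x y : ℕ) (l : Fin n) : ℕ :=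
  if (l : ℕ) < j then lam l - rowInd k l else if (l : ℕ) = j then x
  else if (l : ℕ) = j + 1 then y else mu l

lemma twoRowPartition_cases (lam mu : Fin n → ℕ) (j k x y : ℕ) (l : Fin n) :
    ((l : ℕ) < j ∧ twoRowPartition lam mu j k x y l = lam l - rowInd k l) ∨
    ((l : ℕ) = j ∧ twoRowPartition lam mu j k x y l = x) ∨
    ((l : ℕ) = j + 1 ∧ twoRowPartition lam mu j k x y l = y) ∨
    (j + 1 < (l : ℕ) ∧ twoRowPartition lam mu j k x y l = mu l) := by
  unfold twoRowPartition
  split_ifs with h1 h2 h3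
  · exact Or.inl ⟨h1, rfl⟩
  · exact Or.inr (Or.inl ⟨h2, rfl⟩)
  · exact Or.inr (Or.inr (Or.inl ⟨h3, rfl⟩))
  · exact Or.inr (Or.inr (Or.inr ⟨by omega, rfl⟩))

/-- The zigzag obstruction for the partitions of `twoRowPartition`. -/
lemma not_isIntegralPolytope_of_twoRowPartition {lam mu : Fin n → ℕ}
    (hlam : Antitone lam) (hmu : Antitone mu) (hN : ∑ j, lam j = ∑ j, mu j + N)
    (k x y : ℕ) {j j' c d : Fin n} (hj : (j' : ℕ) = j + 1) (hcj : c ≠ j) (hdj : d ≠ j')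
    (hcd : c ≠ d)
    (hxy : x = y + if (c : ℕ) = j' then 1 else 0)
    (h : ∀ κ : Fin n → ℕ, (∀ l : Fin n, ((l : ℕ) < j ∧ κ l = lam l - rowInd k l) ∨
        ((l : ℕ) = j ∧ κ l = x) ∨ ((l : ℕ) = j' ∧ κ l = y) ∨ ((j' : ℕ) < l ∧ κ l = mu l)) →
      (∀ l : Fin n, mu l ≤ κ l ∧ κ l + rowInd j l + rowInd j' l + rowInd c l + rowInd d l ≤ lam l) ∧
      ∀ k l : Fin n, (l : ℕ) = k + 1 → lam l ≤ lam k → mu l ≤ mu k →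
        κ l ≤ κ k ∧ κ l + rowInd j l ≤ κ k + rowInd j k ∧ κ l + rowInd c l ≤ κ k + rowInd c k ∧
        κ l + rowInd j l + rowInd c l + rowInd d l ≤ κ k + rowInd j k + rowInd c k + rowInd d k ∧
        κ l + rowInd j l + rowInd j' l + rowInd c l + rowInd d l ≤
          κ k + rowInd j k + rowInd j' k + rowInd c k + rowInd d k) :
    ¬ IsIntegralPolytope (gtPolytope lam mu (fun _ : Fin N => 1)) := by
  have hκ := twoRowPartition_cases lam mu j k x y
  obtain ⟨h1, h2⟩ := h (twoRowPartition lam mu j k x y) fun l => by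
    have := hκ l
    omega
  have hm : ∀ {f : Fin n → ℕ}, Antitone f → ∀ k l : Fin n, (l : ℕ) = k + 1 → f l ≤ f k :=
    fun hf k l hkl => hf (Fin.le_def.2 (by omega))
  replace h2 := fun k l hkl => h2 k l hkl (hm hlam k l hkl) (hm hmu k l hkl)
  refine not_isIntegralPolytope_of_zigzag hlam hmu hN j'.2 c.2 d.2 hj (Fin.val_ne_of_ne hcj)
    (Fin.val_ne_of_ne hdj) (Fin.val_ne_of_ne hcd) (fun k l hkl => (h2 k l hkl).1)
    (fun k l hkl => (h2 k l hkl).2.1) (fun k l hkl => (h2 k l hkl).2.2.1)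
    (fun k l hkl => (h2 k l hkl).2.2.2.1) (fun k l hkl => (h2 k l hkl).2.2.2.2)
    (fun l => rfl) (fun a b ha hb => ?_) (fun l => (h1 l).1) (fun l => (h1 l).2)
  have ha' := hκ a
  have hb' := hκ b
  split_ifs at hxy ⊢ <;> omega

lemma eq_and_eq_of_val_eq (lam mu : Fin n → ℕ) (i l : Fin n) (h : (l : ℕ) = i) :
    lam l = lam i ∧ mu l = mu i := by
  rw [Fin.ext h]
  exact ⟨rfl, rfl⟩

/-- Two rows that contain the shape `(3, 2) / (1, 0)`. -/
lemma not_isIntegralPolytope_of_rows {lam mu : Fin n → ℕ}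
    (hlam : Antitone lam) (hmu : Antitone mu) (hle : mu ≤ lam) (hN : ∑ j, lam j = ∑ j, mu j + N)
    {j j' : Fin n} (hj : (j' : ℕ) = j + 1) (c : ℕ) (h1 : mu j + 1 ≤ c) (h2 : mu j' + 2 ≤ c)
    (h3 : c ≤ lam j') (h4 : c + 1 ≤ lam j) :
    ¬ IsIntegralPolytope (gtPolytope lam mu (fun _ : Fin N => 1)) := by
  have hne : j' ≠ j := fun h => by omega
  -- Both rows gain two boxes and end at lengths `c + 1` and `c`. The index `n` names no row, so no
  -- box is removed above row `j`.
  refine not_isIntegralPolytope_of_twoRowPartition hlam hmu hN n (c - 1) (c - 2) (c := j')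
    (d := j) hj hne hne.symm hne (by simp; omega)
    fun κ hκ => ⟨fun l => ?_, fun k l hkl hl hm => ?_⟩
  · have := hκ l
    have := eq_and_eq_of_val_eq lam mu j l
    have := eq_and_eq_of_val_eq lam mu j' l
    have : mu l ≤ lam l := hle l
    have := rowInd_cases n l
    have := rowInd_cases j l
    have := rowInd_cases j' l
    clear hκ
    omega
  · have := hκ l
    have := hκ k
    have := eq_and_eq_of_val_eq lam mu j l
    have := eq_and_eq_of_val_eq lam mu j' l
    have := eq_and_eq_of_val_eq lam mu j k
    have := eq_and_eq_of_val_eq lam mu j' k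
    have : mu l ≤ lam l := hle l
    have : mu k ≤ lam k := hle k
    have := rowInd_cases n l
    have := rowInd_cases j l
    have := rowInd_cases j' l
    have := rowInd_cases n k
    have := rowInd_cases j k
    have := rowInd_cases j' k
    clear hκ
    refine ⟨?_, ?_, ?_, ?_, ?_⟩ <;> omega

/-- Two overlapping rows, the upper one with at least two boxes, and a nonempty row above them. -/
lemma not_isIntegralPolytope_of_upper_row_of_above {lam mu : Fin n → ℕ}
    (hlam : Antitone lam) (hmu : Antitone mu) (hle : mu ≤ lam) (hN : ∑ j, lam j = ∑ j, mu j + N)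
    {i j j' : Fin n} (hj : (j' : ℕ) = j + 1) (h1 : mu j < lam j') (h2 : mu j + 2 ≤ lam j)
    (hi : i < j) (h3 : mu i < lam i) (h4 : ∀ l, i < l → l < j → mu l = lam l) :
    ¬ IsIntegralPolytope (gtPolytope lam mu (fun _ : Fin N => 1)) := by
  have hne : j' ≠ j := fun h => by omega
  have hjj : mu j' ≤ mu j ∧ lam j' ≤ lam j :=
    ⟨hmu (Fin.le_def.2 (by omega)), hlam (Fin.le_def.2 (by omega))⟩
  -- The box for `C` is the last box of row `i`, removed beforehand. It is an outer corner because
  -- the rows between `i` and `j` contain no box.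
  refine not_isIntegralPolytope_of_twoRowPartition hlam hmu hN i (mu j) (mu j) (c := i)
    (d := j) hj hi.ne hne.symm hi.ne (by simp; omega)
    fun κ hκ => ⟨fun l => ?_, fun k l hkl hl hm => ?_⟩
  · have := hκ l
    have := eq_and_eq_of_val_eq lam mu i l
    have := eq_and_eq_of_val_eq lam mu j l
    have := eq_and_eq_of_val_eq lam mu j' l
    have := h4 l
    have : mu l ≤ lam l := hle l
    have := rowInd_cases i l
    have := rowInd_cases j l
    have := rowInd_cases j' l
    clear hκ hN
    omega
  · have hl' := hκ l
    have hk := hκ k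
    have := eq_and_eq_of_val_eq lam mu i l
    have := eq_and_eq_of_val_eq lam mu j l
    have := eq_and_eq_of_val_eq lam mu j' l
    have := h4 l
    have : mu l ≤ lam l := hle l
    have := rowInd_cases i l
    have := rowInd_cases j l
    have := rowInd_cases j' l
    have := eq_and_eq_of_val_eq lam mu i k
    have := eq_and_eq_of_val_eq lam mu j k
    have := eq_and_eq_of_val_eq lam mu j' k
    have := h4 k
    have : mu k ≤ lam k := hle k
    have := rowInd_cases i k
    have := rowInd_cases j k
    have := rowInd_cases j' k
    clear hκ hN
    rcases hk with hk | hk | hk | hk <;> rcases hl' with hl' | hl' | hl' | hl' <;>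
    first
    | (exfalso; clear * - hk hl' hkl hj; omega)
    | (refine ⟨?_, ?_, ?_, ?_, ?_⟩ <;> omega)

/-- Two overlapping rows, the upper one with at least two boxes, and an inner corner below them. -/
lemma not_isIntegralPolytope_of_upper_row_of_below {lam mu : Fin n → ℕ}
    (hlam : Antitone lam) (hmu : Antitone mu) (hle : mu ≤ lam) (hN : ∑ j, lam j = ∑ j, mu j + N)
    {i j j' : Fin n} (hj : (j' : ℕ) = j + 1) (h1 : mu j < lam j') (h2 : mu j + 2 ≤ lam j)
    (hi : j' < i) (h3 : mu i < lam i) (h4 : ∀ l : Fin n, (i : ℕ) = l + 1 → mu i < mu l) :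
    ¬ IsIntegralPolytope (gtPolytope lam mu (fun _ : Fin N => 1)) := by
  have hne : j' ≠ j := fun h => by omega
  have hjj : mu j' ≤ mu j ∧ lam j' ≤ lam j :=
    ⟨hmu (Fin.le_def.2 (by omega)), hlam (Fin.le_def.2 (by omega))⟩
  have hij : i ≠ j := fun h => by omega
  -- Here the box for `C` is the first box of row `i`, addable because `i` is an inner corner.
  refine not_isIntegralPolytope_of_twoRowPartition hlam hmu hN n (mu j) (mu j) (c := i)
    (d := j) hj hij hne.symm hij (by simp; omega)
    fun κ hκ => ⟨fun l => ?_, fun k l hkl hl hm => ?_⟩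
  · have := hκ l
    have := eq_and_eq_of_val_eq lam mu i l
    have := eq_and_eq_of_val_eq lam mu j l
    have := eq_and_eq_of_val_eq lam mu j' l
    have := h4 l
    have : mu l ≤ lam l := hle l
    have := rowInd_cases n l
    have := rowInd_cases i l
    have := rowInd_cases j l
    have := rowInd_cases j' l
    clear hκ hN
    omega
  · have hl' := hκ l
    have hk := hκ k
    have := eq_and_eq_of_val_eq lam mu i l
    have := eq_and_eq_of_val_eq lam mu j l
    have := eq_and_eq_of_val_eq lam mu j' l
    have := h4 l
    have : mu l ≤ lam l := hle l
    have := rowInd_cases n l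
    have := rowInd_cases i l
    have := rowInd_cases j l
    have := rowInd_cases j' l
    have := eq_and_eq_of_val_eq lam mu i k
    have := eq_and_eq_of_val_eq lam mu j k
    have := eq_and_eq_of_val_eq lam mu j' k
    have := h4 k
    have : mu k ≤ lam k := hle k
    have := rowInd_cases n k
    have := rowInd_cases i k
    have := rowInd_cases j k
    have := rowInd_cases j' k
    clear hκ hN
    rcases hk with hk | hk | hk | hk <;> rcases hl' with hl' | hl' | hl' | hl' <;>
    first
    | (exfalso; clear * - hk hl' hkl hj; omega)
    | (refine ⟨?_, ?_, ?_, ?_, ?_⟩ <;> omega)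

/-- Two overlapping rows, the lower one with at least two boxes, and a nonempty row below them. -/
lemma not_isIntegralPolytope_of_lower_row_of_below {lam mu : Fin n → ℕ}
    (hlam : Antitone lam) (hmu : Antitone mu) (hle : mu ≤ lam) (hN : ∑ j, lam j = ∑ j, mu j + N)
    {i j j' : Fin n} (hj : (j' : ℕ) = j + 1) (h1 : mu j < lam j') (h2 : mu j' + 2 ≤ lam j')
    (hi : j' < i) (h3 : mu i < lam i) (h4 : ∀ l, j' < l → l < i → mu l = lam l) :
    ¬ IsIntegralPolytope (gtPolytope lam mu (fun _ : Fin N => 1)) := by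
  have hne : j' ≠ j := fun h => by omega
  have hjj : mu j' ≤ mu j ∧ lam j' ≤ lam j :=
    ⟨hmu (Fin.le_def.2 (by omega)), hlam (Fin.le_def.2 (by omega))⟩
  -- Row `j'` receives the last two of its boxes (`B = C`), and the box for `D` is the first one of
  -- row `i`.
  refine not_isIntegralPolytope_of_twoRowPartition hlam hmu hN n (lam j' - 1) (lam j' - 2)
    (c := j') (d := i) hj hne hi.ne' hi.ne (by simp; omega)
    fun κ hκ => ⟨fun l => ?_, fun k l hkl hl hm => ?_⟩
  · have := hκ l
    have := eq_and_eq_of_val_eq lam mu i l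
    have := eq_and_eq_of_val_eq lam mu j l
    have := eq_and_eq_of_val_eq lam mu j' l
    have := h4 l
    have : mu l ≤ lam l := hle l
    have := rowInd_cases n l
    have := rowInd_cases i l
    have := rowInd_cases j l
    have := rowInd_cases j' l
    clear hκ hN
    omega
  · have hl' := hκ l
    have hk := hκ k
    have := eq_and_eq_of_val_eq lam mu i l
    have := eq_and_eq_of_val_eq lam mu j l
    have := eq_and_eq_of_val_eq lam mu j' l
    have := h4 l
    have : mu l ≤ lam l := hle l
    have := rowInd_cases n l
    have := rowInd_cases i l
    have := rowInd_cases j l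
    have := rowInd_cases j' l
    have := eq_and_eq_of_val_eq lam mu i k
    have := eq_and_eq_of_val_eq lam mu j k
    have := eq_and_eq_of_val_eq lam mu j' k
    have := h4 k
    have : mu k ≤ lam k := hle k
    have := rowInd_cases n k
    have := rowInd_cases i k
    have := rowInd_cases j k
    have := rowInd_cases j' k
    clear hκ hN
    rcases hk with hk | hk | hk | hk <;> rcases hl' with hl' | hl' | hl' | hl' <;>
    first
    | (exfalso; clear * - hk hl' hkl hj; omega)
    | (refine ⟨?_, ?_, ?_, ?_, ?_⟩ <;> omega)

/-- Two overlapping rows, the lower one with at least two boxes, and an outer corner above them. -/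
lemma not_isIntegralPolytope_of_lower_row_of_above {lam mu : Fin n → ℕ}
    (hlam : Antitone lam) (hmu : Antitone mu) (hle : mu ≤ lam) (hN : ∑ j, lam j = ∑ j, mu j + N)
    {i j j' : Fin n} (hj : (j' : ℕ) = j + 1) (h1 : mu j < lam j') (h2 : mu j' + 2 ≤ lam j')
    (hi : i < j) (h3 : mu i < lam i) (h4 : ∀ l : Fin n, (l : ℕ) = i + 1 → lam l < lam i) :
    ¬ IsIntegralPolytope (gtPolytope lam mu (fun _ : Fin N => 1)) := by
  have hne : j' ≠ j := fun h => by omega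
  have hjj : mu j' ≤ mu j ∧ lam j' ≤ lam j :=
    ⟨hmu (Fin.le_def.2 (by omega)), hlam (Fin.le_def.2 (by omega))⟩
  have hij : i ≠ j' := fun h => by omega
  -- Again `B = C`; the box for `D` is the outer corner of row `i`, removed beforehand.
  refine not_isIntegralPolytope_of_twoRowPartition hlam hmu hN i (lam j' - 1) (lam j' - 2)
    (c := j') (d := i) hj hne hij hij.symm (by simp; omega)
    fun κ hκ => ⟨fun l => ?_, fun k l hkl hl hm => ?_⟩
  · have := hκ l
    have := eq_and_eq_of_val_eq lam mu i l
    have := eq_and_eq_of_val_eq lam mu j l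
    have := eq_and_eq_of_val_eq lam mu j' l
    have := h4 l
    have : mu l ≤ lam l := hle l
    have := rowInd_cases i l
    have := rowInd_cases j l
    have := rowInd_cases j' l
    clear hκ hN
    omega
  · have hl' := hκ l
    have hk := hκ k
    have := eq_and_eq_of_val_eq lam mu i l
    have := eq_and_eq_of_val_eq lam mu j l
    have := eq_and_eq_of_val_eq lam mu j' l
    have := h4 l
    have : mu l ≤ lam l := hle l
    have := rowInd_cases i l
    have := rowInd_cases j l
    have := rowInd_cases j' l
    have := eq_and_eq_of_val_eq lam mu i k
    have := eq_and_eq_of_val_eq lam mu j k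
    have := eq_and_eq_of_val_eq lam mu j' k
    have := h4 k
    have : mu k ≤ lam k := hle k
    have := rowInd_cases i k
    have := rowInd_cases j k
    have := rowInd_cases j' k
    clear hκ hN
    rcases hk with hk | hk | hk | hk <;> rcases hl' with hl' | hl' | hl' | hl' <;>
    first
    | (exfalso; clear * - hk hl' hkl hj; omega)
    | (refine ⟨?_, ?_, ?_, ?_, ?_⟩ <;> omega)

end Shapes

/-! ## Integral Gelfand–Tsetlin polytopes are compressed -/

section Compressed

variable {n N : ℕ}

lemma exists_int_gtRow {x : Fin (N + 1) × Fin n → ℝ} (hx : IsIntegerPoint x) (i : ℕ) (j : Fin n) :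
    ∃ m : ℤ, gtRow x i j = m := by
  unfold gtRow
  split_ifs
  · exact hx _
  · exact ⟨0, by simp⟩

lemma add_one_le_of_isInt {a b : ℝ} (ha : ∃ m : ℤ, a = m) (hb : ∃ m : ℤ, b = m) (h : a < b) :
    a + 1 ≤ b := by
  obtain ⟨m, rfl⟩ := ha
  obtain ⟨k, rfl⟩ := hb
  exact_mod_cast h

variable {lam mu : Fin n → ℕ}

/-- In an integral Gelfand–Tsetlin polytope of weight one, if the row `j` has at least two boxes
and there is a box below one of them, then the first step of each pattern is in the row `j`. -/
lemma first_step_of_isIntegralPolytope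
    (hlam : Antitone lam) (hmu : Antitone mu) (hle : mu ≤ lam) (hN : ∑ j, lam j = ∑ j, mu j + N)
    (hint : IsIntegralPolytope (gtPolytope lam mu (fun _ : Fin N => 1))) (hN0 : 0 < N)
    {j j' : Fin n} (hj : (j' : ℕ) = j + 1) (h1 : mu j < lam j') (h2 : mu j + 2 ≤ lam j)
    {x : Fin (N + 1) × Fin n → ℝ} (hx : x ∈ gtPolytope lam mu (fun _ : Fin N => 1)) :
    (mu j : ℝ) + 1 ≤ gtRow x 1 j := by
  -- It suffices to treat a vertex where this entry is no larger. Being integral, the vertex adds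
  -- its first box in a single row `k`, and `k ≠ j` leads to an obstruction.
  obtain ⟨v, hv, hvx, -⟩ := exists_gt_vertex_le hx
    (ContinuousLinearMap.proj (R := ℝ) (φ := fun _ => ℝ)
      ((⟨1, by omega⟩ : Fin (N + 1)), j))
  simp only [ContinuousLinearMap.proj_apply] at hvx
  rw [← gtRow_coe v, ← gtRow_coe x] at hvx
  refine le_trans ?_ hvx
  change (mu j : ℝ) + 1 ≤ gtRow v 1 j
  obtain ⟨hv0, hvN, hvs⟩ := mem_gtPolytope_iff.1 hv.1
  have hvi := fun i l => exists_int_gtRow (hint v hv) i l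
  have hs := hvs 0 hN0
  rw [zero_add] at hs
  have hkey : ∀ k, gtRow v 0 k < gtRow v 1 k → gtRow v 0 k + 1 ≤ gtRow v 1 k :=
    fun k hk => add_one_le_of_isInt (hvi 0 k) (hvi 1 k) hk
  obtain ⟨k, hk⟩ : ∃ k, gtRow v 0 k < gtRow v 1 k := by
    by_contra! h
    have h1 := hs.sum
    have h2 := Finset.sum_le_sum fun k (_ : k ∈ Finset.univ) => h k
    linarith
  replace hk := hkey k hk
  rw [hv0] at hk
  by_cases hkj : k = j
  · exact hkj ▸ hk
  exfalso
  have hkl : mu k < lam k := by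
    have := gtRow_mono (fun i hi => (hvs i hi).le) (show 1 ≤ N by omega) le_rfl k
    rw [hvN] at this
    have : (mu k : ℝ) + 1 ≤ lam k := hk.trans this
    exact_mod_cast this
  have hcorner : ∀ l : Fin n, (k : ℕ) = l + 1 → mu k < mu l := by
    intro l hl
    have := hs.diag l k hl
    rw [hv0] at this
    have : (mu k : ℝ) + 1 ≤ mu l := hk.trans this
    exact_mod_cast this
  rcases lt_trichotomy (k : ℕ) j with h | h | h
  -- The nearest nonempty row above `j` replaces `k`.
  · obtain ⟨i, hi, himax⟩ := ({i : Fin n | i < j ∧ mu i < lam i} : Finset (Fin n)).exists_max_image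
      id ⟨k, by simpa using ⟨h, hkl⟩⟩
    simp only [Finset.mem_filter, Finset.mem_univ, true_and, id_eq] at hi himax
    refine not_isIntegralPolytope_of_upper_row_of_above hlam hmu hle hN hj h1 h2 hi.1 hi.2
      (fun l hil hlj => le_antisymm (hle l) (not_lt.1 fun hl => ?_)) hint
    exact absurd (himax l ⟨hlj, hl⟩) (not_le.2 hil)
  · exact hkj (Fin.ext h)
  · by_cases hkj' : k = j'
    · subst hkj'
      have := hcorner j hj
      exact not_isIntegralPolytope_of_rows hlam hmu hle hN hj (mu j + 1) le_rfl (by omega)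
        (by omega) (by omega) hint
    · have hlt : j' < k := Fin.lt_def.2 (by
        have : (k : ℕ) ≠ j' := fun h => hkj' (Fin.ext h)
        omega)
      exact not_isIntegralPolytope_of_upper_row_of_below hlam hmu hle hN hj h1 h2 hlt hkl
        hcorner hint

/-- In an integral Gelfand–Tsetlin polytope of weight one, if the row `j + 1` has at least two
boxes and there is a box above one of them, then the last step of each pattern is in the row
`j + 1`. -/
lemma last_step_of_isIntegralPolytope {M : ℕ} (hM : N = M + 1)
    (hlam : Antitone lam) (hmu : Antitone mu) (hle : mu ≤ lam) (hN : ∑ j, lam j = ∑ j, mu j + N)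
    (hint : IsIntegralPolytope (gtPolytope lam mu (fun _ : Fin N => 1)))
    {j j' : Fin n} (hj : (j' : ℕ) = j + 1) (h1 : mu j < lam j') (h2 : mu j' + 2 ≤ lam j')
    {x : Fin (N + 1) × Fin n → ℝ} (hx : x ∈ gtPolytope lam mu (fun _ : Fin N => 1)) :
    gtRow x M j' + 1 ≤ lam j' := by
  obtain ⟨v, hv, hvx, -⟩ := exists_gt_vertex_le hx
    (-ContinuousLinearMap.proj (R := ℝ) (φ := fun _ => ℝ)
      ((⟨M, by omega⟩ : Fin (N + 1)), j'))
  simp only [neg_apply, ContinuousLinearMap.proj_apply, neg_le_neg_iff] at hvx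
  rw [← gtRow_coe v, ← gtRow_coe x] at hvx
  refine le_trans (add_le_add_left hvx 1) ?_
  change gtRow v M j' + 1 ≤ lam j'
  obtain ⟨hv0, hvN, hvs⟩ := mem_gtPolytope_iff.1 hv.1
  have hvi := fun i l => exists_int_gtRow (hint v hv) i l
  have hs := hvs M (by omega)
  rw [← hM] at hs
  have hkey : ∀ k, gtRow v M k < gtRow v N k → gtRow v M k + 1 ≤ gtRow v N k :=
    fun k hk => add_one_le_of_isInt (hvi M k) (hvi N k) hk
  obtain ⟨k, hk⟩ : ∃ k, gtRow v M k < gtRow v N k := by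
    by_contra! h
    have h1 := hs.sum
    have h2 := Finset.sum_le_sum fun k (_ : k ∈ Finset.univ) => h k
    linarith
  replace hk := hkey k hk
  rw [hvN] at hk
  by_cases hkj : k = j'
  · exact hkj ▸ hk
  exfalso
  have hkl : mu k < lam k := by
    have := gtRow_mono (fun i hi => (hvs i hi).le) (Nat.zero_le M) (by omega) k
    rw [hv0] at this
    have : (mu k : ℝ) + 1 ≤ lam k := by linarith
    exact_mod_cast this
  have hcorner : ∀ l : Fin n, (l : ℕ) = k + 1 → lam l < lam k := by
    intro l hl
    have := hs.diag k l hl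
    rw [hvN] at this
    have : (lam l : ℝ) + 1 ≤ lam k := by linarith
    exact_mod_cast this
  rcases lt_trichotomy (k : ℕ) j' with h | h | h
  · by_cases hkj' : k = j
    · subst hkj'
      have := hcorner j' hj
      exact not_isIntegralPolytope_of_rows hlam hmu hle hN hj (lam j') (by omega) h2
        le_rfl (by omega) hint
    · have hlt : k < j := Fin.lt_def.2 (by
        have : (k : ℕ) ≠ j := fun h => hkj' (Fin.ext h)
        omega)
      exact not_isIntegralPolytope_of_lower_row_of_above hlam hmu hle hN hj h1 h2 hlt hkl
        hcorner hint
  · exact hkj (Fin.ext h)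
  · obtain ⟨i, hi, himin⟩ := ({i : Fin n | j' < i ∧ mu i < lam i} : Finset (Fin n)).exists_min_image
      id ⟨k, by simpa using ⟨h, hkl⟩⟩
    simp only [Finset.mem_filter, Finset.mem_univ, true_and, id_eq] at hi himin
    refine not_isIntegralPolytope_of_lower_row_of_below hlam hmu hle hN hj h1 h2 hi.1 hi.2
      (fun l hil hlj => le_antisymm (hle l) (not_lt.1 fun hl => ?_)) hint
    exact absurd (himin l ⟨hil, hl⟩) (not_le.2 hlj)

/-- A diagonal inequality between two overlapping rows, one of which has at least two boxes,
follows from the other constraints if the first and the last step are known. -/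
lemma diag_of_steps (hlam : Antitone lam) (hmu : Antitone mu) {z : ℕ → Fin n → ℝ}
    (h0 : ∀ j, z 0 j = mu j) (hzN : ∀ j, z N j = lam j)
    (hz : ∀ i < N, ∀ j, z i j ≤ z (i + 1) j)
    (hsum : ∀ i < N, ∑ j, z (i + 1) j - ∑ j, z i j = 1)
    {j j' : Fin n} (hj : (j' : ℕ) = j + 1)
    (hwidth : mu j + 2 ≤ lam j ∨ mu j' + 2 ≤ lam j') (hov : lam j' ≤ mu j + 2)
    (hfirst : mu j + 2 ≤ lam j → (mu j : ℝ) + 1 ≤ z 1 j)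
    (hlast : ∀ M, N = M + 1 → mu j' + 2 ≤ lam j' → z M j' + 1 ≤ lam j')
    {i : ℕ} (hi : i < N) : z (i + 1) j' ≤ z i j := by
  have hjj : j ≤ j' := Fin.le_def.2 (by omega)
  have hne : j' ≠ j := fun h => by omega
  have hm : (mu j' : ℝ) ≤ mu j := by exact_mod_cast hmu hjj
  have hl : (lam j' : ℝ) ≤ lam j := by exact_mod_cast hlam hjj
  have hub := gtRow_mono hz (show i + 1 ≤ N by omega) le_rfl j'
  rw [hzN] at hub
  have hlb := gtRow_mono hz (Nat.zero_le i) hi.le j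
  rw [h0] at hlb
  by_cases hr' : mu j' + 2 ≤ lam j'
  · obtain ⟨M, rfl⟩ : ∃ M, N = M + 1 := ⟨N - 1, by omega⟩
    have hM := hlast M rfl hr'
    -- In the last step row `j` is at rest, so it already has length `lam j`. Earlier, row `j'` has
    -- length at most `lam j' - 1`.
    rcases eq_or_ne i M with rfl | hiM
    · have := eq_of_add_one_le (hz i hi) (hsum i hi) (k := j') (l := j)
        (by rw [hzN]; exact hM) hne.symm
      rw [← this, hzN, hzN]
      exact hl
    · have hub' := gtRow_mono hz (show i + 1 ≤ M by omega) (by omega) j'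
      by_cases hr : mu j + 2 ≤ lam j
      · rcases Nat.eq_zero_or_pos i with rfl | hi0
        · have := eq_of_add_one_le (hz 0 hi) (hsum 0 hi) (k := j) (l := j')
            (by rw [h0]; exact hfirst hr) hne
          rw [this, h0, h0]
          exact hm
        · have hlb' := gtRow_mono hz (show 1 ≤ i by omega) hi.le j
          have := hfirst hr
          have hov' : (lam j' : ℝ) ≤ mu j + 2 := by exact_mod_cast hov
          linarith
      · have hr'' : lam j ≤ mu j + 1 := by omega
        have hr3 : (lam j : ℝ) ≤ mu j + 1 := by exact_mod_cast hr''
        linarith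
  · have hr : mu j + 2 ≤ lam j := by omega
    have hr'' : lam j' ≤ mu j' + 1 := by omega
    have hr3 : (lam j' : ℝ) ≤ mu j' + 1 := by exact_mod_cast hr''
    -- In the first step row `j'` is at rest with length `mu j'`. Afterwards row `j` has length at
    -- least `mu j + 1`, and row `j'` never exceeds `mu j' + 1`.
    rcases Nat.eq_zero_or_pos i with rfl | hi0
    · have := eq_of_add_one_le (hz 0 hi) (hsum 0 hi) (k := j) (l := j')
        (by rw [h0]; exact hfirst hr) hne
      rw [this, h0, h0]
      exact hm
    · have hlb' := gtRow_mono hz (show 1 ≤ i by omega) hi.le j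
      have := hfirst hr
      linarith

/-! ### The system of integer inequalities -/

/-- The coordinate functional of a Gelfand–Tsetlin pattern. -/
noncomputable def gtEntry (N n : ℕ) (i : Fin (N + 1)) (j : Fin n) :
    (Fin (N + 1) × Fin n → ℝ) →L[ℝ] ℝ :=
  ContinuousLinearMap.proj (R := ℝ) (φ := fun _ => ℝ) (i, j)

lemma gtEntry_apply (i : Fin (N + 1)) (j : Fin n) (x : Fin (N + 1) × Fin n → ℝ) :
    gtEntry N n i j x = x (i, j) := rfl

/-- The inequalities, in the form `q.2 ≤ q.1 x`, from which the polytope is described: the defining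
ones, and those that prescribe the row in which a step takes place. -/
noncomputable def gtConstraints (N : ℕ) {n : ℕ} (lam mu : Fin n → ℕ) :
    Set (((Fin (N + 1) × Fin n → ℝ) →L[ℝ] ℝ) × ℝ) :=
  (Set.range fun j => (gtEntry N n (Fin.last N) j, (lam j : ℝ))) ∪
  (Set.range fun j => (-gtEntry N n (Fin.last N) j, -(lam j : ℝ))) ∪
  (Set.range fun j => (gtEntry N n 0 j, (mu j : ℝ))) ∪
  (Set.range fun j => (-gtEntry N n 0 j, -(mu j : ℝ))) ∪
  (Set.range fun i : Fin N => (∑ j, (gtEntry N n i.succ j - gtEntry N n i.castSucc j), (1 : ℝ))) ∪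
  (Set.range fun i : Fin N =>
    (-∑ j, (gtEntry N n i.succ j - gtEntry N n i.castSucc j), (-1 : ℝ))) ∪
  (Set.range fun a : Fin N × Fin n =>
    (gtEntry N n a.1.succ a.2 - gtEntry N n a.1.castSucc a.2, (0 : ℝ))) ∪
  (Set.range fun a : Fin N × Fin n =>
    (gtEntry N n a.1.succ a.2 - gtEntry N n a.1.castSucc a.2, (1 : ℝ))) ∪
  (Set.range fun a : Fin N × Fin n × Fin n =>
    (gtEntry N n a.1.castSucc a.2.1 - gtEntry N n a.1.succ a.2.2, (0 : ℝ)))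

lemma finite_gtConstraints : (gtConstraints N lam mu).Finite := by
  unfold gtConstraints
  simp only [Set.finite_union, Set.finite_range, and_self]

lemma isInt_of_mem_gtConstraints {q : ((Fin (N + 1) × Fin n → ℝ) →L[ℝ] ℝ) × ℝ}
    (hq : q ∈ gtConstraints N lam mu) :
    (∀ x, IsIntegerPoint x → ∃ z : ℤ, q.1 x = z) ∧ ∃ z : ℤ, q.2 = z := by
  have hsum : ∀ (x : Fin (N + 1) × Fin n → ℝ), IsIntegerPoint x → ∀ i : Fin N,
      ∃ z : ℤ, ∑ j, (x (i.succ, j) - x (i.castSucc, j)) = z := by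
    intro x hx i
    choose f hf using hx
    exact ⟨∑ j, (f (i.succ, j) - f (i.castSucc, j)), by simp [hf]⟩
  have hsub : ∀ (x : Fin (N + 1) × Fin n → ℝ), IsIntegerPoint x → ∀ a b,
      ∃ z : ℤ, x a - x b = z := by
    intro x hx a b
    choose f hf using hx
    exact ⟨f a - f b, by simp [hf]⟩
  rcases hq with (((((((⟨j, rfl⟩ | ⟨j, rfl⟩) | ⟨j, rfl⟩) | ⟨j, rfl⟩) | ⟨i, rfl⟩) | ⟨i, rfl⟩) |
    ⟨a, rfl⟩) | ⟨a, rfl⟩) | ⟨a, rfl⟩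
  · exact ⟨fun x hx => hx _, lam j, by simp⟩
  · refine ⟨fun x hx => ?_, -lam j, by simp⟩
    obtain ⟨z, hz⟩ := hx (Fin.last N, j)
    exact ⟨-z, by simp [gtEntry_apply, hz]⟩
  · exact ⟨fun x hx => hx _, mu j, by simp⟩
  · refine ⟨fun x hx => ?_, -mu j, by simp⟩
    obtain ⟨z, hz⟩ := hx (0, j)
    exact ⟨-z, by simp [gtEntry_apply, hz]⟩
  · refine ⟨fun x hx => ?_, 1, by simp⟩
    simpa only [sum_apply, sub_apply, gtEntry_apply] using hsum x hx i
  · refine ⟨fun x hx => ?_, -1, by simp⟩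
    obtain ⟨z, hz⟩ := hsum x hx i
    refine ⟨-z, ?_⟩
    simp only [neg_apply, sum_apply, sub_apply, gtEntry_apply, hz, Int.cast_neg]
  · exact ⟨fun x hx => hsub x hx _ _, 0, by simp⟩
  · exact ⟨fun x hx => hsub x hx _ _, 1, by simp⟩
  · exact ⟨fun x hx => hsub x hx _ _, 0, by simp⟩

end Compressed

theorem mainTheorem1 {n N : ℕ} (lam mu : Fin n → ℕ)
    (hlam : Antitone lam) (hmu : Antitone mu) (hle : mu ≤ lam)
    (hN : ∑ j, lam j = ∑ j, mu j + N)
    (hint : IsIntegralPolytope (gtPolytope lam mu (fun _ : Fin N => 1))) :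
    IsCompressed (gtPolytope lam mu (fun _ : Fin N => 1)) := by
  set P := gtPolytope lam mu (fun _ : Fin N => 1)
  -- `gtConstraints` also contains inequalities that fail on `P` or are too wide. `S` keeps the
  -- valid ones of width one, so what remains is that these still cut out `P`.
  set S := {q ∈ gtConstraints N lam mu | (∀ x ∈ P, q.2 ≤ q.1 x) ∧
    ∀ v ∈ P, IsIntegerPoint v → q.1 v ≤ q.2 + 1}
  refine isCompressed_of_width_le_one hint (isCompact_gtPolytope lam mu) (S := S)
    (finite_gtConstraints.subset (Set.sep_subset _ _)) ?_
    (fun q hq => (isInt_of_mem_gtConstraints hq.1).1)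
    (fun q hq => (isInt_of_mem_gtConstraints hq.1).2) fun q hq v hv => hq.2.2 v hv.1 (hint v hv)
  refine Set.Subset.antisymm (fun x hx q hq => hq.2.1 x hx) fun x hx => ?_
  replace hx : ∀ q ∈ S, q.2 ≤ q.1 x := hx
  have hup0 : ∀ v ∈ P, ∀ (i : Fin N) j, v (i.castSucc, j) ≤ v (i.succ, j) := fun v hv i j => by
    rw [← gtRow_castSucc v, ← gtRow_succ v]
    exact ((mem_gtPolytope_iff.1 hv).2.2 i i.2).le j
  have hup1 : ∀ v ∈ P, ∀ (i : Fin N) j, v (i.succ, j) ≤ v (i.castSucc, j) + 1 := fun v hv i j => by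
    rw [← gtRow_castSucc v, ← gtRow_succ v]
    exact ((mem_gtPolytope_iff.1 hv).2.2 i i.2).le_add_one j
  have hsumP : ∀ v ∈ P, ∀ i : Fin N, ∑ j, (v (i.succ, j) - v (i.castSucc, j)) = 1 :=
    fun v hv i => by
      rw [Finset.sum_sub_distrib]
      simpa using hv.2.2.2 i
  have htop : ∀ j, gtRow x N j = lam j := fun j => by
    have h1 := hx (gtEntry N n (Fin.last N) j, (lam j : ℝ))
      ⟨Or.inl <| Or.inl <| Or.inl <| Or.inl <| Or.inl <| Or.inl <| Or.inl <| Or.inl <| ⟨j, rfl⟩,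
        fun v hv => (hv.2.1 j).ge, fun v hv _ => by
        simp [gtEntry_apply, hv.2.1 j]⟩
    have h2 := hx (-gtEntry N n (Fin.last N) j, -(lam j : ℝ))
      ⟨Or.inl <| Or.inl <| Or.inl <| Or.inl <| Or.inl <| Or.inl <| Or.inl <| Or.inr ⟨j, rfl⟩,
        fun v hv => by simp [gtEntry_apply, hv.2.1 j], fun v hv _ => by
        simp [gtEntry_apply, hv.2.1 j]⟩
    refine le_antisymm ?_ ?_ <;> rw [show gtRow x N j = _ from gtRow_coe x (Fin.last N) j]
    · simpa [gtEntry_apply] using h2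
    · exact h1
  have hbot : ∀ j, gtRow x 0 j = mu j := fun j => by
    have h1 := hx (gtEntry N n 0 j, (mu j : ℝ))
      ⟨Or.inl <| Or.inl <| Or.inl <| Or.inl <| Or.inl <| Or.inl <| Or.inr ⟨j, rfl⟩,
        fun v hv => (hv.2.2.1 j).ge, fun v hv _ => by
        simp [gtEntry_apply, hv.2.2.1 j]⟩
    have h2 := hx (-gtEntry N n 0 j, -(mu j : ℝ))
      ⟨Or.inl <| Or.inl <| Or.inl <| Or.inl <| Or.inl <| Or.inr ⟨j, rfl⟩,
        fun v hv => by simp [gtEntry_apply, hv.2.2.1 j], fun v hv _ => by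
        simp [gtEntry_apply, hv.2.2.1 j]⟩
    refine le_antisymm ?_ ?_ <;> rw [show gtRow x 0 j = _ from gtRow_coe x 0 j]
    · simpa [gtEntry_apply] using h2
    · exact h1
  have hsum : ∀ i < N, ∑ j, gtRow x (i + 1) j - ∑ j, gtRow x i j = 1 := fun i hi => by
    have h1 := hx (∑ j, (gtEntry N n (Fin.succ ⟨i, hi⟩) j - gtEntry N n (Fin.castSucc ⟨i, hi⟩) j), 1)
      ⟨Or.inl <| Or.inl <| Or.inl <| Or.inl <| Or.inr ⟨⟨i, hi⟩, rfl⟩,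
        fun v hv => ?_, fun v hv _ => ?_⟩
    have h2 := hx
      (-∑ j, (gtEntry N n (Fin.succ ⟨i, hi⟩) j - gtEntry N n (Fin.castSucc ⟨i, hi⟩) j), -1)
      ⟨Or.inl <| Or.inl <| Or.inl <| Or.inr ⟨⟨i, hi⟩, rfl⟩,
        fun v hv => ?_, fun v hv _ => ?_⟩
    · rw [← Finset.sum_sub_distrib]
      simp only [gtRow_succ x ⟨i, hi⟩, gtRow_castSucc x ⟨i, hi⟩]
      simp only [neg_apply, sum_apply, sub_apply, gtEntry_apply] at h1 h2
      linarith
    all_goals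
      simp only [neg_apply, sum_apply, sub_apply, gtEntry_apply]
      have := hsumP v hv ⟨i, hi⟩
      linarith
  have hup : ∀ i < N, ∀ j, gtRow x i j ≤ gtRow x (i + 1) j := fun i hi j => by
    have h1 := hx (gtEntry N n (Fin.succ ⟨i, hi⟩) j - gtEntry N n (Fin.castSucc ⟨i, hi⟩) j, 0)
      ⟨Or.inl <| Or.inl <| Or.inr ⟨(⟨i, hi⟩, j), rfl⟩,
        fun v hv => ?_, fun v hv _ => ?_⟩
    · rw [gtRow_succ x ⟨i, hi⟩, gtRow_castSucc x ⟨i, hi⟩]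
      simpa [gtEntry_apply] using h1
    · simpa [gtEntry_apply] using hup0 v hv ⟨i, hi⟩ j
    · have := hup1 v hv ⟨i, hi⟩ j
      simp only [sub_apply, gtEntry_apply]
      linarith
  have hforced : ∀ (i : ℕ) (hi : i < N) (j : Fin n),
      (∀ v ∈ P, gtRow v i j + 1 ≤ gtRow v (i + 1) j) → gtRow x i j + 1 ≤ gtRow x (i + 1) j := by
    intro i hi j h
    have h1 := hx (gtEntry N n (Fin.succ ⟨i, hi⟩) j - gtEntry N n (Fin.castSucc ⟨i, hi⟩) j, 1)
      ⟨Or.inl <| Or.inr ⟨(⟨i, hi⟩, j), rfl⟩,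
        fun v hv => ?_, fun v hv _ => ?_⟩
    · rw [gtRow_succ x ⟨i, hi⟩, gtRow_castSucc x ⟨i, hi⟩]
      simp only [sub_apply, gtEntry_apply] at h1
      linarith
    · have := h v hv
      rw [gtRow_succ v ⟨i, hi⟩, gtRow_castSucc v ⟨i, hi⟩] at this
      simp only [sub_apply, gtEntry_apply]
      linarith
    · have := hup1 v hv ⟨i, hi⟩ j
      simp only [sub_apply, gtEntry_apply]
      linarith
  refine mem_gtPolytope_iff.2 ⟨hbot, htop, fun i hi => ⟨hup i hi, fun j j' hj => ?_, hsum i hi⟩⟩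
  have hjj : j ≤ j' := Fin.le_def.2 (by omega)
  by_cases h1 : mu j < lam j'
  swap
  · have hub := gtRow_mono hup (show i + 1 ≤ N by omega) le_rfl j'
    have hlb := gtRow_mono hup (Nat.zero_le i) hi.le j
    rw [htop] at hub
    rw [hbot] at hlb
    have : (lam j' : ℝ) ≤ mu j := by exact_mod_cast not_lt.1 h1
    linarith
  by_cases hw : mu j + 2 ≤ lam j ∨ mu j' + 2 ≤ lam j'
  · refine diag_of_steps hlam hmu hbot htop hup hsum hj hw ?_ ?_ ?_ hi
    · by_contra! hov
      have := hlam hjj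
      have := hmu hjj
      -- With `mu j + 3 ≤ lam j'`, both rows contain the two boxes ending at `mu j + 3` and `mu j +
      -- 2` respectively.
      exact not_isIntegralPolytope_of_rows hlam hmu hle hN hj (mu j + 2) (by omega) (by omega)
        (by omega) (by omega) hint
    · intro h2
      have := hforced 0 (by omega) j fun v hv => by
        rw [(mem_gtPolytope_iff.1 hv).1]
        exact first_step_of_isIntegralPolytope hlam hmu hle hN hint (by omega) hj h1 h2 hv
      rwa [hbot] at this
    · intro M hM h2
      have := hforced M (by omega) j' fun v hv => by
        rw [← hM, (mem_gtPolytope_iff.1 hv).2.1]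
        exact last_step_of_isIntegralPolytope hM hlam hmu hle hN hint hj h1 h2 hv
      rwa [← hM, htop] at this
  · push Not at hw
    have h2 := hx (gtEntry N n (Fin.castSucc ⟨i, hi⟩) j - gtEntry N n (Fin.succ ⟨i, hi⟩) j', 0)
      ⟨Or.inr ⟨(⟨i, hi⟩, j, j'), rfl⟩,
        fun v hv => ?_, fun v hv _ => ?_⟩
    · rw [gtRow_succ x ⟨i, hi⟩, gtRow_castSucc x ⟨i, hi⟩]
      simpa [gtEntry_apply] using h2
    · have := ((mem_gtPolytope_iff.1 hv).2.2 i hi).diag j j' hj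
      rw [gtRow_succ v ⟨i, hi⟩, gtRow_castSucc v ⟨i, hi⟩] at this
      simpa [gtEntry_apply] using this
    · obtain ⟨hv0, hvN, hvs⟩ := mem_gtPolytope_iff.1 hv
      have hlb := gtRow_mono (fun i hi => (hvs i hi).le) (Nat.zero_le (i + 1)) (by omega) j'
      have hub := gtRow_mono (fun i hi => (hvs i hi).le) hi.le le_rfl j
      rw [hv0, gtRow_succ v ⟨i, hi⟩] at hlb
      rw [hvN, gtRow_castSucc v ⟨i, hi⟩] at hub
      -- Overlapping rows with at most one box each: `lam j ≤ mu j + 1 ≤ lam j' ≤ mu j' + 1`.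
      have h3 : lam j ≤ mu j' + 1 := by omega
      have h4 : (lam j : ℝ) ≤ mu j' + 1 := by exact_mod_cast h3
      simp only [sub_apply, gtEntry_apply]
      linarith
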